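/- **Setting.** Manifolds are smooth, finite-dimensional, Hausdorff, second countable, without boundary. A Courant algebroid (CA) is a smooth vector bundle $E\to M$ with a non-degenerate symmetric fibrewise form $\langle\,,\rangle$, a bundle map $\rho:E\to TM$ and an $\mathbb R$-bilinear bracket on $\Gamma(E)$ such that, with $u\cdot f:=\rho(u)f$ and $\langle u,d_Ef\rangle:=u\cdot f$, $$[u,[v,w]]=[[u,v],w]+[v,[u,w]],\quad [u,fv]=f[u,v]+(u\cdot f)v,$$ $$u\cdot\langle v,w\rangle=\langle[u,v],w\rangle+\langle v,[u,w]\rangle,\quad [u,v]+[v,u]=d_E\langle u,v\rangle .$$ If $\tau:M'\to M$ is smooth, a CA structure on $E'=\tau^*E$ (with form $\langle\,,\rangle'$, bracket $[\,,]'$, anchor $\rho'$) makes $E'$ a *CA-pullback* of $E$ if $\langle\tau^*u,\tau^*v\rangle'=\tau^*\langle u,v\rangle$, $[\tau^*u,\tau^*v]'=\tau^*[u,v]$ and $\tau_*(\rho'(\tau^*u))=\rho(u)$ for all $u,v\in\Gamma(E)$. A *divergence* on $E$ is an $\mathbb R$-linear map $\mathrm{div}:\Gamma(E)\to C^\infty(M)$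 with $\mathrm{div}(fa)=f\,\mathrm{div}\,a+a\cdot f$. Let $V_+\subset E$ be an oriented smooth subbundle of rank $n\equiv 2 \pmod 4$ on which $\langle\,,\rangle$ is non-degenerate of Lorentzian signature (either sign convention), let $V_-=V_+^\perp$, and let subscripts $\pm$ denote the orthogonal projections. For $a\in\Gamma(V_+)$, $b\in\Gamma(V_-)$ put $$\mathrm{GRic}(a,b)=\mathrm{div}\,[b,a]_+-b\cdot\mathrm{div}\,a-\mathrm{Tr}_{V_+}[[\,\cdot\,,b]_-,a]_+ ,$$ and, in a local pseudo-orthonormal frame $e_a$ of $V_+$ with dual frame $e^a$ (the result does not depend on the frame), $$\mathcal R=(\mathrm{div}\,e^a)(\mathrm{div}\,e_a)+2e^a\cdot(\mathrm{div}\,e_a)-\tfrac16\langle e_a,[e_b,e_c]\rangle\langle e^a,[e^b,e^c]\rangle-\tfrac12\langle[e_a,e_b]_-,[e^a,e^b]_-\rangle .$$ *Spinors.* Let $V$ be a real vector space of dimension $2k$ with a non-degenerate symmetric form, isometric to the fibres of $E$; $\mathrm{Cl}(V)$ has the relations $uv+vu=\langle u,v\rangle$, and $\mathrm{Pin}(V)$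 is generated by the $v\in V$ with $v^2=\pm1$ in $\mathrm{Cl}(V)$, acting on $V$ by $v\mapsto gvg^{-1}$. Let $\mathbb K=\mathbb R$ or $\mathbb C$, and fix a splitting $V\otimes\mathbb K=L_1\oplus L_2$ into Lagrangian subspaces and a volume element of $L_1$ (so for $\mathbb K=\mathbb R$ the form has symmetric signature). Then $\mathrm{Cl}(V)$ acts on $S_V=\bigwedge L_1$, with $L_1$ acting by multiplication and $L_2\cong L_1^*$ by contraction, and $S_V$ has the pairing $(A,B)=(\vartheta A\wedge B)^{\mathrm{top}}\in\mathbb C$, where $\vartheta A=i^pA$ for $A$ of degree $p$. Fix a spin structure on $E$: isometric trivializations of $E$ over an open cover $(U_i)$, and a lift of their transition maps to a smooth $\mathrm{Pin}(V)$-valued cocycle $g_{ij}$. A section $F$ of the spinor bundle $S_E$ is a family of smooth maps $F_i:U_i\to S_V$ with $F_i=g_{ij}F_j$ on $U_i\cap U_j$; all formulas below are read in each of the trivializations. $\tau^*S_E$ and $\tau^*F$ are given by the pulled-back trivializations, $g_{ij}\circ\tau$ and $F_i\circ\tau$. Put, with $e_\alpha$ the frame of $E$ given by a basis of $V$ and $e^\alpha$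 the dual frame, $$D_{\mathrm{div}}=e^\alpha\bigl(\rho(e_\alpha)+\tfrac12\mathrm{div}\,e_\alpha\bigr)-\tfrac16e^\alpha e^\beta e^\gamma\langle[e_\alpha,e_\beta],e_\gamma\rangle ,\qquad R_{V_+}=2^{n/2}e_1\cdots e_n$$ (in $R_{V_+}$, $e_1,\dots,e_n$ is an oriented pseudo-orthonormal basis of $V_+$). For $F$ of even or odd parity, set $\nu=1$ if $F$ is even and $\nu=i$ if $F$ is odd. The triple $(V_+\subset E,\mathrm{div},F)$ *solves the generalized type II SUGRA equations* if $$R_{V_+}F=F,\quad D_{\mathrm{div}}F=0,\quad \mathrm{GRic}(u_+,v_-)=\tfrac{i}{8\nu}(u_+F,v_-F)\ \ \forall u_+\in\Gamma(V_+),\,v_-\in\Gamma(V_-),\quad \mathcal R=0 .$$ **Theorem (PL T-duality of type II SUGRA).** Let $E\to M$ be a CA, $\tau:M'\to M$ a smooth map and $E'=\tau^*E$ a CA-pullback of $E$. If $(V_+\subset E,\mathrm{div},F)$ solves the generalized type II SUGRA equations, then there is a unique divergence $\tau^*\mathrm{div}$ on $E'$ with $(\tau^*\mathrm{div})(\tau^*u)=\tau^*(\mathrm{div}\,u)$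 for all $u\in\Gamma(E)$, and $(\tau^*V_+\subset E',\tau^*\mathrm{div},\tau^*F)$ solves the generalized type II SUGRA equations, with $F$ and $\tau^*F$ of the same parity. -/

import Mathlib

open scoped Manifold ContDiff Bundle Topology

noncomputable section

/-! ### Smooth sections, directional derivatives -/

section Sections

variable {EM : Type*} [NormedAddCommGroup EM] [NormedSpace ℝ EM]
  {M : Type*} [TopologicalSpace M] [ChartedSpace EM M]
  {F : Type*} [NormedAddCommGroup F] [NormedSpace ℝ F]
  {E : M → Type*} [TopologicalSpace (Bundle.TotalSpace F E)] [∀ x, TopologicalSpace (E x)]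
  [∀ x, AddCommGroup (E x)] [∀ x, Module ℝ (E x)] [FiberBundle F E] [VectorBundle ℝ F E]

/-- The derivative of a real function `f` along a tangent vector `X` at `x`. -/
def dirDeriv {x : M} (X : TangentSpace 𝓘(ℝ, EM) x) (f : M → ℝ) : ℝ :=
  mfderiv 𝓘(ℝ, EM) 𝓘(ℝ, ℝ) f x X

/-- The product of a smooth function and a smooth section. -/
def smulSection (f : C^∞⟮𝓘(ℝ, EM), M; ℝ⟯) (s : Cₛ^∞⟮𝓘(ℝ, EM); F, E⟯) :
    Cₛ^∞⟮𝓘(ℝ, EM); F, E⟯ where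
  toFun := (f : M → ℝ) • (s : ∀ x, E x)
  contMDiff_toFun := f.contMDiff.smul_section s.contMDiff

/-- Evaluation of smooth sections at a point. -/
def evalSection (x : M) : Cₛ^∞⟮𝓘(ℝ, EM); F, E⟯ →ₗ[ℝ] E x where
  toFun s := s x
  map_add' _ _ := rfl
  map_smul' _ _ := rfl

/-- Every vector of a fibre is the value of a global smooth section. -/
theorem evalSection_surjective [FiniteDimensional ℝ EM] [T2Space M]
    [IsManifold 𝓘(ℝ, EM) ∞ M] [ContMDiffVectorBundle ∞ F E 𝓘(ℝ, EM)] (x : M) :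
    Function.Surjective (evalSection (EM := EM) (F := F) (E := E) x) := by
  intro v
  obtain ⟨s, hs, hσ⟩ :=
    FiberBundle.exists_contMDiffOn_extend (k := (∞ : WithTop ℕ∞)) 𝓘(ℝ, EM) F (V := E) v
  obtain ⟨u, hus, huo, hxu⟩ := mem_nhds_iff.1 hs
  obtain ⟨ψ, -, hψ⟩ :=
    (SmoothBumpFunction.nhds_basis_tsupport (I := 𝓘(ℝ, EM)) x).mem_iff.1 (huo.mem_nhds hxu)
  refine ⟨⟨(ψ : M → ℝ) • FiberBundle.extend F v,
    ContMDiffOn.smul_section_of_tsupport ψ.contMDiff.contMDiffOn huo hψ (hσ.mono hus)⟩, ?_⟩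
  change ψ x • FiberBundle.extend F v x = v
  simp

/-- A linear choice of global smooth sections extending the vectors of the fibre at `x`. -/
def extendSection [FiniteDimensional ℝ EM] [T2Space M]
    [IsManifold 𝓘(ℝ, EM) ∞ M] [ContMDiffVectorBundle ∞ F E 𝓘(ℝ, EM)] (x : M) :
    E x →ₗ[ℝ] Cₛ^∞⟮𝓘(ℝ, EM); F, E⟯ :=
  Classical.choose (LinearMap.exists_rightInverse_of_surjective _
    (LinearMap.range_eq_top.2 (evalSection_surjective (EM := EM) (F := F) (E := E) x)))

theorem extendSection_apply [FiniteDimensional ℝ EM] [T2Space M]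
    [IsManifold 𝓘(ℝ, EM) ∞ M] [ContMDiffVectorBundle ∞ F E 𝓘(ℝ, EM)] (x : M) (v : E x) :
    extendSection (EM := EM) (F := F) (E := E) x v x = v :=
  LinearMap.congr_fun (Classical.choose_spec (LinearMap.exists_rightInverse_of_surjective _
    (LinearMap.range_eq_top.2 (evalSection_surjective (EM := EM) (F := F) (E := E) x)))) v

variable {EM' : Type*} [NormedAddCommGroup EM'] [NormedSpace ℝ EM']
  {M' : Type*} [TopologicalSpace M'] [ChartedSpace EM' M']

/-- The fibres of a pullback bundle are the fibres of the original bundle. -/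
instance pullbackAddCommGroup (f : M' → M) (x : M') : AddCommGroup ((f *ᵖ E) x) where
  __ := (inferInstance : AddCommMonoid ((f *ᵖ E) x))
  neg := (inferInstance : AddCommGroup (E (f x))).neg
  sub := (inferInstance : AddCommGroup (E (f x))).sub
  sub_eq_add_neg := (inferInstance : AddCommGroup (E (f x))).sub_eq_add_neg
  zsmul := (inferInstance : AddCommGroup (E (f x))).zsmul
  zsmul_zero' := (inferInstance : AddCommGroup (E (f x))).zsmul_zero'
  zsmul_succ' := (inferInstance : AddCommGroup (E (f x))).zsmul_succ'
  zsmul_neg' := (inferInstance : AddCommGroup (E (f x))).zsmul_neg'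
  neg_add_cancel := (inferInstance : AddCommGroup (E (f x))).neg_add_cancel

/-- The pullback `τ^* u` of a smooth section, a smooth section of the pullback bundle. -/
def pullSection (τ : C^∞⟮𝓘(ℝ, EM'), M'; 𝓘(ℝ, EM), M⟯) (u : Cₛ^∞⟮𝓘(ℝ, EM); F, E⟯) :
    Cₛ^∞⟮𝓘(ℝ, EM'); F, ((τ : M' → M) *ᵖ E)⟯ where
  toFun x := u (τ x)
  contMDiff_toFun := by
    intro x
    refine (Bundle.contMDiffAt_section (E := (τ : M' → M) *ᵖ E) (s := fun x ↦ u (τ x)) x).2 ?_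
    exact ((Bundle.contMDiffAt_section _).1 (u.contMDiff (τ x))).comp x (τ.contMDiff x)

end Sections

/-! ### Courant algebroids, divergences, pullbacks -/

section Courant

variable (EM : Type*) [NormedAddCommGroup EM] [NormedSpace ℝ EM]
  {M : Type*} [TopologicalSpace M] [ChartedSpace EM M]
  (F : Type*) [NormedAddCommGroup F] [NormedSpace ℝ F]
  (E : M → Type*) [TopologicalSpace (Bundle.TotalSpace F E)] [∀ x, TopologicalSpace (E x)]
  [∀ x, AddCommGroup (E x)] [∀ x, Module ℝ (E x)] [FiberBundle F E] [VectorBundle ℝ F E]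

/-- A Courant algebroid structure on the vector bundle `E → M`. -/
structure CourantAlgebroid [IsManifold 𝓘(ℝ, EM) ∞ M] where
  /-- the fibrewise inner product -/
  pairing : ∀ x, LinearMap.BilinForm ℝ (E x)
  pairing_symm : ∀ x (u v : E x), pairing x u v = pairing x v u
  pairing_nondegenerate : ∀ x, (pairing x).Nondegenerate
  pairing_smooth : ∀ u v : Cₛ^∞⟮𝓘(ℝ, EM); F, E⟯,
    ContMDiff 𝓘(ℝ, EM) 𝓘(ℝ, ℝ) ∞ fun x ↦ pairing x (u x) (v x)
  /-- the anchor, a vector bundle map `E → TM` -/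
  anchor : ∀ x, E x →ₗ[ℝ] TangentSpace 𝓘(ℝ, EM) x
  anchor_smooth : ∀ u : Cₛ^∞⟮𝓘(ℝ, EM); F, E⟯,
    ContMDiff 𝓘(ℝ, EM) 𝓘(ℝ, EM).tangent ∞
      fun x ↦ (⟨x, anchor x (u x)⟩ : TangentBundle 𝓘(ℝ, EM) M)
  /-- the bracket of sections -/
  bracket : Cₛ^∞⟮𝓘(ℝ, EM); F, E⟯ →ₗ[ℝ] Cₛ^∞⟮𝓘(ℝ, EM); F, E⟯ →ₗ[ℝ] Cₛ^∞⟮𝓘(ℝ, EM); F, E⟯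
  jacobi : ∀ u v w, bracket u (bracket v w) = bracket (bracket u v) w + bracket v (bracket u w)
  leibniz : ∀ u v (f : C^∞⟮𝓘(ℝ, EM), M; ℝ⟯) x,
    bracket u (smulSection f v) x = f x • bracket u v x + dirDeriv (anchor x (u x)) f • v x
  invariant : ∀ u v w x,
    dirDeriv (anchor x (u x)) (fun y ↦ pairing y (v y) (w y)) =
      pairing x (bracket u v x) (w x) + pairing x (v x) (bracket u w x)
  /-- `[u, v] + [v, u] = d_E ⟨u, v⟩`, where `⟨w, d_E f⟩ = ρ(w) f` -/
  bracket_add_swap : ∀ u v x (w : E x),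
    pairing x w (bracket u v x + bracket v u x) =
      dirDeriv (anchor x w) (fun y ↦ pairing y (u y) (v y))

variable {EM F E}

/-- A divergence on a Courant algebroid. -/
@[ext] structure Divergence [IsManifold 𝓘(ℝ, EM) ∞ M] (C : CourantAlgebroid EM F E) where
  toFun : Cₛ^∞⟮𝓘(ℝ, EM); F, E⟯ →ₗ[ℝ] C^∞⟮𝓘(ℝ, EM), M; ℝ⟯
  leibniz : ∀ (f : C^∞⟮𝓘(ℝ, EM), M; ℝ⟯) a x,
    toFun (smulSection f a) x = f x * toFun a x + dirDeriv (C.anchor x (a x)) f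

variable {EM' : Type*} [NormedAddCommGroup EM'] [NormedSpace ℝ EM']
  {M' : Type*} [TopologicalSpace M'] [ChartedSpace EM' M']

/-- The Courant algebroid structure `C'` on `τ^* E` makes it a CA-pullback of `C`. -/
structure IsCAPullback [IsManifold 𝓘(ℝ, EM) ∞ M] [IsManifold 𝓘(ℝ, EM') ∞ M']
    (C : CourantAlgebroid EM F E) (τ : C^∞⟮𝓘(ℝ, EM'), M'; 𝓘(ℝ, EM), M⟯)
    (C' : CourantAlgebroid EM' F ((τ : M' → M) *ᵖ E)) : Prop where
  pairing_eq : ∀ (u v : Cₛ^∞⟮𝓘(ℝ, EM); F, E⟯) (x : M'),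
    C'.pairing x (pullSection τ u x) (pullSection τ v x) = C.pairing (τ x) (u (τ x)) (v (τ x))
  bracket_eq : ∀ u v : Cₛ^∞⟮𝓘(ℝ, EM); F, E⟯,
    C'.bracket (pullSection τ u) (pullSection τ v) = pullSection τ (C.bracket u v)
  anchor_eq : ∀ (u : Cₛ^∞⟮𝓘(ℝ, EM); F, E⟯) (x : M'),
    mfderiv 𝓘(ℝ, EM') 𝓘(ℝ, EM) τ x (C'.anchor x (pullSection τ u x)) = C.anchor (τ x) (u (τ x))

end Courant

/-! ### Oriented Lorentzian generalized pseudometrics -/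

/-- `e` is a pseudo-orthonormal basis of the subspace `V`, with signs `s`, positively oriented
for `o`. -/
def IsOrientedOrthonormal {W : Type*} [AddCommGroup W] [Module ℝ W]
    (B : LinearMap.BilinForm ℝ W) (V : Submodule ℝ W) {n : ℕ} (o : Orientation ℝ V (Fin n))
    (s : Fin n → ℤˣ) (e : Fin n → W) : Prop :=
  (∀ a b, B (e a) (e b) = if a = b then ((s a : ℤ) : ℝ) else 0) ∧
    ∃ b : Module.Basis (Fin n) ℝ V, (∀ a, (b a : W) = e a) ∧ b.orientation = o

section Projection

variable {W : Type*} [AddCommGroup W] [Module ℝ W] {B : LinearMap.BilinForm ℝ W}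
  {V : Submodule ℝ W} {n : ℕ} {o : Orientation ℝ V (Fin n)} {s : Fin n → ℤˣ} {e : Fin n → W}

/-- The orthogonal projection onto the span of the pseudo-orthonormal family `e`. -/
def frameProj (B : LinearMap.BilinForm ℝ W) (s : Fin n → ℤˣ) (e : Fin n → W) : W →ₗ[ℝ] W :=
  ∑ a, ((s a : ℤ) : ℝ) • (B (e a)).smulRight (e a)

theorem frameProj_apply (w : W) :
    frameProj B s e w = ∑ a, ((s a : ℤ) : ℝ) • B (e a) w • e a := by
  simp [frameProj]

theorem IsOrientedOrthonormal.frameProj_mem (h : IsOrientedOrthonormal B V o s e) (w : W) :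
    frameProj B s e w ∈ V := by
  obtain ⟨-, b, hb, -⟩ := h
  rw [frameProj_apply]
  exact V.sum_mem fun a _ ↦ V.smul_mem _ (V.smul_mem _ (hb a ▸ (b a).2))

theorem IsOrientedOrthonormal.pairing_frameProj (h : IsOrientedOrthonormal B V o s e) (w v : W)
    (hv : v ∈ V) : B v (frameProj B s e w) = B v w := by
  obtain ⟨h1, b, hb, -⟩ := h
  have key : ∀ c, B (e c) (frameProj B s e w) = B (e c) w := by
    intro c
    rw [frameProj_apply]
    have : ((s c : ℤ) : ℝ) * ((s c : ℤ) : ℝ) = 1 := by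
      rcases Int.units_eq_one_or (s c) with h | h <;> simp [h]
    simp only [map_sum, map_smul, h1, smul_eq_mul, mul_ite, mul_zero, Finset.sum_ite_eq,
      Finset.mem_univ, if_true]
    linear_combination (B (e c) w) * this
  have := b.sum_repr ⟨v, hv⟩
  have hv' : v = ∑ a, b.repr ⟨v, hv⟩ a • e a := by
    have h3 := congrArg (Subtype.val : V → W) this
    simp only [AddSubmonoidClass.coe_finsetSum, Submodule.coe_smul, hb] at h3
    exact h3.symm
  rw [hv']
  simp [map_sum, key]

theorem IsOrientedOrthonormal.frameProj_unique (h : IsOrientedOrthonormal B V o s e) (w p : W)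
    (hp : p ∈ V) (hpw : ∀ v ∈ V, B v p = B v w) : p = frameProj B s e w := by
  have h0 := h
  obtain ⟨h1, b, hb, -⟩ := h0
  have := b.sum_repr ⟨p, hp⟩
  have hv' : p = ∑ a, b.repr ⟨p, hp⟩ a • e a := by
    have h3 := congrArg (Subtype.val : V → W) this
    simp only [AddSubmonoidClass.coe_finsetSum, Submodule.coe_smul, hb] at h3
    exact h3.symm
  have hc : ∀ c, b.repr ⟨p, hp⟩ c = ((s c : ℤ) : ℝ) * B (e c) w := by
    intro c
    have hs : ((s c : ℤ) : ℝ) * ((s c : ℤ) : ℝ) = 1 := by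
      rcases Int.units_eq_one_or (s c) with h | h <;> simp [h]
    have h2 : B (e c) p = b.repr ⟨p, hp⟩ c * ((s c : ℤ) : ℝ) := by
      conv_lhs => rw [hv']
      simp [map_sum, h1]
    rw [← hpw (e c) (hb c ▸ (b c).2), h2]
    linear_combination (-(b.repr ⟨p, hp⟩ c)) * hs
  conv_lhs => rw [hv']
  rw [frameProj_apply]
  exact Finset.sum_congr rfl fun c _ ↦ by rw [hc, smul_smul]

end Projection

section Pseudometric

variable {EM : Type*} [NormedAddCommGroup EM] [NormedSpace ℝ EM]
  {M : Type*} [TopologicalSpace M] [ChartedSpace EM M] [IsManifold 𝓘(ℝ, EM) ∞ M]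
  {F : Type*} [NormedAddCommGroup F] [NormedSpace ℝ F]
  {E : M → Type*} [TopologicalSpace (Bundle.TotalSpace F E)] [∀ x, TopologicalSpace (E x)]
  [∀ x, AddCommGroup (E x)] [∀ x, Module ℝ (E x)] [FiberBundle F E] [VectorBundle ℝ F E]

/-- An oriented smooth subbundle `V₊ ⊂ E` of rank `n` on which the inner product is Lorentzian.
`sign` lists the signs of the inner product on a pseudo-orthonormal basis; smoothness of `V₊`
and local constancy of its orientation are expressed by local pseudo-orthonormal oriented frames
(which are restrictions of global smooth sections of `E`). -/
structure LorentzianPseudometric (C : CourantAlgebroid EM F E) (n : ℕ) where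
  /-- the fibres of `V₊` -/
  plus : ∀ x, Submodule ℝ (E x)
  orient : ∀ x, Orientation ℝ (plus x) (Fin n)
  sign : Fin n → ℤˣ
  lorentzian : (∃! a, sign a = -1) ∨ (∃! a, sign a = 1)
  exists_frame : ∀ x₀, ∃ e : Fin n → Cₛ^∞⟮𝓘(ℝ, EM); F, E⟯, ∀ᶠ x in 𝓝 x₀,
    IsOrientedOrthonormal (C.pairing x) (plus x) (orient x) sign (fun a ↦ e a x)

namespace LorentzianPseudometric

variable {C : CourantAlgebroid EM F E} {n : ℕ} (V : LorentzianPseudometric C n)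

/-- The fibres of `V₋ = V₊^⊥`. -/
def minus (x : M) : Submodule ℝ (E x) where
  carrier := {w | ∀ v ∈ V.plus x, C.pairing x v w = 0}
  add_mem' ha hb v hv := by simp [ha v hv, hb v hv]
  zero_mem' v _ := by simp
  smul_mem' c w hw v hv := by simp [hw v hv]

/-- `e` is an oriented pseudo-orthonormal frame of `V₊` near `x₀`. -/
def IsFrameNear (x₀ : M) (e : Fin n → Cₛ^∞⟮𝓘(ℝ, EM); F, E⟯) : Prop :=
  ∀ᶠ x in 𝓝 x₀,
    IsOrientedOrthonormal (C.pairing x) (V.plus x) (V.orient x) V.sign (fun a ↦ e a x)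

/-- The orthogonal projection `E_x → (V₊)_x`, as an endomorphism of `E_x`. -/
def proj (x : M) : E x →ₗ[ℝ] E x :=
  frameProj (C.pairing x) V.sign fun a ↦ Classical.choose (V.exists_frame x) a x

theorem proj_mem (x : M) (w : E x) : V.proj x w ∈ V.plus x :=
  (Classical.choose_spec (V.exists_frame x)).self_of_nhds.frameProj_mem w

theorem pairing_proj (x : M) (w v : E x) (hv : v ∈ V.plus x) :
    C.pairing x v (V.proj x w) = C.pairing x v w :=
  (Classical.choose_spec (V.exists_frame x)).self_of_nhds.pairing_frameProj w v hv

/-- The projection `u ↦ u₊` of sections of `E` to sections of `V₊`. -/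
def projPlus : Cₛ^∞⟮𝓘(ℝ, EM); F, E⟯ →ₗ[ℝ] Cₛ^∞⟮𝓘(ℝ, EM); F, E⟯ where
  toFun u :=
    { toFun := fun x ↦ V.proj x (u x)
      contMDiff_toFun := by
        intro x₀
        obtain ⟨e, he⟩ := V.exists_frame x₀
        have h1 : ContMDiff 𝓘(ℝ, EM) (𝓘(ℝ, EM).prod 𝓘(ℝ, F)) ∞ fun x ↦
            Bundle.TotalSpace.mk' F x (∑ a, (fun y ↦ ((V.sign a : ℤ) : ℝ) *
              C.pairing y (e a y) (u y)) x • e a x) :=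
          ContMDiff.sum_section fun a _ ↦
            (contMDiff_const.mul (C.pairing_smooth (e a) u)).smul_section (e a).contMDiff
        refine (h1 x₀).congr_of_eventuallyEq ?_
        filter_upwards [he] with x hx
        rw [hx.frameProj_unique (u x) _ (V.proj_mem x _) (fun v hv ↦ V.pairing_proj x _ v hv),
          frameProj_apply]
        simp only [mul_smul] }
  map_add' u v := by
    ext x
    exact map_add (V.proj x) (u x) (v x)
  map_smul' c u := by
    ext x
    exact map_smul (V.proj x) c (u x)

/-- The projection `u ↦ u₋` of sections of `E` to sections of `V₋`. -/
def projMinus : Cₛ^∞⟮𝓘(ℝ, EM); F, E⟯ →ₗ[ℝ] Cₛ^∞⟮𝓘(ℝ, EM); F, E⟯ :=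
  LinearMap.id - V.projPlus

/-- The trace at `x` of the `C^∞(M)`-linear map `[[·, b]₋, a]₊` on sections of `V₊`,
computed as the trace of the endomorphism `w ↦ [[w₊, b]₋, a]₊` of `E_x`. -/
def bracketTrace [FiniteDimensional ℝ EM] [T2Space M] [ContMDiffVectorBundle ∞ F E 𝓘(ℝ, EM)]
    (a b : Cₛ^∞⟮𝓘(ℝ, EM); F, E⟯) (x : M) : ℝ :=
  LinearMap.trace ℝ (E x) (evalSection x ∘ₗ V.projPlus ∘ₗ C.bracket.flip a ∘ₗ V.projMinus ∘ₗ
    C.bracket.flip b ∘ₗ V.projPlus ∘ₗ extendSection x)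

/-- The generalized Ricci tensor
`GRic(a₊, b₋) = div [b₋, a₊]₊ - b₋ · div a₊ - Tr_{V₊} [[·, b₋]₋, a₊]₊`. -/
def gRic [FiniteDimensional ℝ EM] [T2Space M] [ContMDiffVectorBundle ∞ F E 𝓘(ℝ, EM)]
    (div : Divergence C) (a b : Cₛ^∞⟮𝓘(ℝ, EM); F, E⟯) (x : M) : ℝ :=
  div.toFun (V.projPlus (C.bracket b a)) x - dirDeriv (C.anchor x (b x)) (div.toFun a) -
    V.bracketTrace a b x

/-- The expression
`(div e^a)(div e_a) + 2 e^a · (div e_a) - (1/6) c_{abc} c^{abc} - (1/2) c_{ab c̄} c^{ab c̄}`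
at `x`, in the pseudo-orthonormal frame `e` of `V₊`; here `c_{abc} = ⟨e_a, [e_b, e_c]⟩` and
`c_{ab c̄} c^{ab c̄} = ⟨[e_a, e_b]₋, [e^a, e^b]₋⟩`. -/
def frameScalar (div : Divergence C) (e : Fin n → Cₛ^∞⟮𝓘(ℝ, EM); F, E⟯) (x : M) : ℝ :=
  (∑ a, ((V.sign a : ℤ) : ℝ) *
      ((div.toFun (e a) x) ^ 2 + 2 * dirDeriv (C.anchor x (e a x)) (div.toFun (e a)))) -
    (1 / 6) * (∑ a, ∑ b, ∑ c, ((V.sign a : ℤ) : ℝ) * ((V.sign b : ℤ) : ℝ) *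
      ((V.sign c : ℤ) : ℝ) * (C.pairing x (e a x) (C.bracket (e b) (e c) x)) ^ 2) -
    (1 / 2) * (∑ a, ∑ b, ((V.sign a : ℤ) : ℝ) * ((V.sign b : ℤ) : ℝ) *
      C.pairing x (V.projMinus (C.bracket (e a) (e b)) x) (V.projMinus (C.bracket (e a) (e b)) x))

/-- The generalized scalar curvature at `x` is `r`. The value of `frameScalar` at `x` does not
depend on the local frame, and local frames exist near every point. -/
def HasScalarCurvatureAt (div : Divergence C) (x : M) (r : ℝ) : Prop :=
  ∃ e : Fin n → Cₛ^∞⟮𝓘(ℝ, EM); F, E⟯, V.IsFrameNear x e ∧ V.frameScalar div e x = r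

variable {EM' : Type*} [NormedAddCommGroup EM'] [NormedSpace ℝ EM']
  {M' : Type*} [TopologicalSpace M'] [ChartedSpace EM' M'] [IsManifold 𝓘(ℝ, EM') ∞ M']
  {τ : C^∞⟮𝓘(ℝ, EM'), M'; 𝓘(ℝ, EM), M⟯} {C' : CourantAlgebroid EM' F ((τ : M' → M) *ᵖ E)}

/-- The pullback `τ^* V₊ ⊂ τ^* E`. -/
def pullback (h : IsCAPullback C τ C') : LorentzianPseudometric C' n where
  plus x := V.plus (τ x)
  orient x := V.orient (τ x)
  sign := V.sign
  lorentzian := V.lorentzian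
  exists_frame x₀ := by
    obtain ⟨e, he⟩ := V.exists_frame (τ x₀)
    refine ⟨fun a ↦ pullSection τ (e a), ?_⟩
    filter_upwards [(τ.contMDiff.continuous.tendsto x₀).eventually he] with x hx
    exact ⟨fun a b ↦ (h.pairing_eq (e a) (e b) x).trans (hx.1 a b), hx.2⟩

end LorentzianPseudometric

end Pseudometric

/-! ### Clifford algebra and spinors of a vector space -/

/-- A real vector space `V` of dimension `2k` with a non-degenerate symmetric bilinear form
`⟨ , ⟩`, and a splitting of `V ⊗ 𝕜` into two Lagrangian subspaces, written as an isometry `split`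
to `L^* ⊕ L` with its natural form, where `L = 𝕜^k` has its standard volume element. For `𝕜 = ℝ`
this is a Lagrangian splitting of `V` itself (so that the form has symmetric signature); for
`𝕜 = ℂ` the signature is arbitrary. -/
structure SpinorModel (𝕜 : Type*) [RCLike 𝕜] (V : Type*) [AddCommGroup V] [Module ℝ V]
    (k : ℕ) where
  form : LinearMap.BilinForm ℝ V
  form_symm : ∀ v w, form v w = form w v
  form_nondegenerate : form.Nondegenerate
  finrank_eq : Module.finrank ℝ V = 2 * k
  split : V →ₗ[ℝ] Module.Dual 𝕜 (Fin k → 𝕜) × (Fin k → 𝕜)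
  split_form : ∀ v w, LinearMap.dualProd 𝕜 (Fin k → 𝕜) (split v) (split w) = (form v w : 𝕜)

/-- The space of spinors, `⋀ L` with `L = 𝕜^k` (the line `(⋀^top L)^{-1/2}` is trivialised by the
volume element of `L`). -/
abbrev SpinorSpace (𝕜 : Type*) [RCLike 𝕜] (k : ℕ) : Type _ := ExteriorAlgebra 𝕜 (Fin k → 𝕜)

section SpinorSpace

variable (𝕜 : Type*) [RCLike 𝕜] (k : ℕ)

instance SpinorSpace.finite_scalars : Module.Finite 𝕜 (SpinorSpace 𝕜 k) := by
  have hbot : ∀ n, k < n → (⋀[𝕜]^n (Fin k → 𝕜)) = ⊥ := by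
    intro n hn
    rw [← Submodule.finrank_eq_zero (R := 𝕜), exteriorPower.finrank_eq]
    exact Nat.choose_eq_zero_of_lt (by simpa using hn)
  have htop : (⨆ n ∈ Finset.range (k + 1), (⋀[𝕜]^n (Fin k → 𝕜))) = ⊤ := by
    rw [eq_top_iff, ← (DirectSum.Decomposition.isInternal
      (fun n : ℕ ↦ ⋀[𝕜]^n (Fin k → 𝕜))).submodule_iSup_eq_top]
    refine iSup_le fun n ↦ ?_
    by_cases hn : n < k + 1
    · exact le_biSup (fun n : ℕ ↦ ⋀[𝕜]^n (Fin k → 𝕜)) (Finset.mem_range.2 hn)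
    · rw [hbot n (by omega)]
      exact bot_le
  refine ⟨?_⟩
  rw [← htop]
  exact Submodule.fg_biSup _ _ fun n _ ↦ Module.Finite.iff_fg.1 inferInstance

instance SpinorSpace.finite_real : Module.Finite ℝ (SpinorSpace 𝕜 k) :=
  Module.Finite.trans 𝕜 (SpinorSpace 𝕜 k)

/-- The linear form on `⋀ L` that is zero below the top degree and the standard determinant on
`⋀^k L`. -/
def topForm : SpinorSpace 𝕜 k →ₗ[𝕜] 𝕜 :=
  ExteriorAlgebra.liftAlternating (R := 𝕜) (M := Fin k → 𝕜)
    (Pi.single (M := fun i ↦ (Fin k → 𝕜) [⋀^Fin i]→ₗ[𝕜] 𝕜) k Matrix.detRowAlternating)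

/-- The pairing `(A, B) = (ϑ A ∧ B)^top` of spinors, where `ϑ A = i^p A` for `A` of degree `p`. -/
def spinorPairing (A B : SpinorSpace 𝕜 k) : ℂ :=
  ∑ p ∈ Finset.range (k + 1), Complex.I ^ p * RCLike.map 𝕜 ℂ (topForm 𝕜 k
    (GradedRing.proj (fun i : ℕ ↦ ⋀[𝕜]^i (Fin k → 𝕜)) p A * B))

end SpinorSpace

namespace SpinorModel

variable {𝕜 : Type*} [RCLike 𝕜] {V : Type*} [AddCommGroup V] [Module ℝ V] {k : ℕ}
  (m : SpinorModel 𝕜 V k)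

/-- The quadratic form `⟨v, v⟩ / 2`, so that `uv + vu = ⟨u, v⟩` in its Clifford algebra. -/
def quad : QuadraticForm ℝ V := ((1 / 2 : ℝ) • m.form).toQuadraticMap

/-- The Clifford algebra `Cl(V)`. -/
abbrev Cl : Type _ := CliffordAlgebra m.quad

/-- `L` acts on `⋀ L` by multiplication and `L^*` by contraction. -/
def gamma : V →ₗ[ℝ] Module.End 𝕜 (SpinorSpace 𝕜 k) where
  toFun v := LinearMap.mulLeft 𝕜 (ExteriorAlgebra.ι 𝕜 (m.split v).2) +
    CliffordAlgebra.contractLeft (m.split v).1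
  map_add' v w := by
    refine LinearMap.ext fun A ↦ ?_
    simp only [map_add, Prod.fst_add, Prod.snd_add, LinearMap.add_apply, LinearMap.mulLeft_apply,
      add_mul]
    abel
  map_smul' c v := by
    refine LinearMap.ext fun A ↦ ?_
    have h1 : (c • m.split v) = (c : 𝕜) • m.split v := by
      rw [← RCLike.algebraMap_eq_ofReal, algebraMap_smul]
    have h2 : ∀ B : Module.End 𝕜 (SpinorSpace 𝕜 k), c • B = (c : 𝕜) • B := fun B ↦ by
      rw [← RCLike.algebraMap_eq_ofReal, algebraMap_smul]
    simp only [map_smul, h1, h2, Prod.smul_fst, Prod.smul_snd, LinearMap.add_apply,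
      LinearMap.smul_apply, LinearMap.mulLeft_apply, smul_add, smul_mul_assoc, RingHom.id_apply]

theorem gamma_sq (v : V) :
    m.gamma v * m.gamma v = algebraMap ℝ (Module.End 𝕜 (SpinorSpace 𝕜 k)) (m.quad v) := by
  refine LinearMap.ext fun A ↦ ?_
  have h := m.split_form v v
  rw [LinearMap.dualProd_apply_apply] at h
  have h2 : (m.split v).1 (m.split v).2 = ((m.quad v : ℝ) : 𝕜) := by
    have h3 : m.quad v = (1 / 2) * m.form v v := by
      simp [quad, LinearMap.BilinMap.toQuadraticMap_apply]
    rw [h3, RCLike.ofReal_mul, ← h]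
    push_cast
    ring
  rw [Module.algebraMap_end_apply]
  have h4 : m.quad v • A = ((m.quad v : ℝ) : 𝕜) • A := by
    rw [← RCLike.algebraMap_eq_ofReal, algebraMap_smul]
  rw [h4, ← h2]
  change ExteriorAlgebra.ι 𝕜 (m.split v).2 * (ExteriorAlgebra.ι 𝕜 (m.split v).2 * A +
    CliffordAlgebra.contractLeft (m.split v).1 A) + CliffordAlgebra.contractLeft (m.split v).1
    (ExteriorAlgebra.ι 𝕜 (m.split v).2 * A + CliffordAlgebra.contractLeft (m.split v).1 A) = _
  have h5 : CliffordAlgebra.contractLeft (m.split v).1 (ExteriorAlgebra.ι 𝕜 (m.split v).2 * A) =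
      (m.split v).1 (m.split v).2 • A - ExteriorAlgebra.ι 𝕜 (m.split v).2 *
        CliffordAlgebra.contractLeft (m.split v).1 A :=
    CliffordAlgebra.contractLeft_ι_mul _ _ _
  rw [mul_add, ← mul_assoc, ExteriorAlgebra.ι_sq_zero, zero_mul, map_add, h5,
    CliffordAlgebra.contractLeft_contractLeft]
  abel

/-- The action of `Cl(V)` on spinors. -/
def act : m.Cl →ₐ[ℝ] Module.End 𝕜 (SpinorSpace 𝕜 k) :=
  CliffordAlgebra.lift m.quad ⟨m.gamma, m.gamma_sq⟩

/-- The group `Pin(V)`, generated by the vectors of square `1` or `-1` in `Cl(V)`. -/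
def Pin : Subgroup m.Clˣ :=
  Subgroup.closure {g | ∃ v : V, (g : m.Cl) = CliffordAlgebra.ι m.quad v ∧
    (m.quad v = 1 ∨ m.quad v = -1)}

end SpinorModel

/-! ### Spin structures and the generating Dirac operator -/

section Spin

variable {EM : Type*} [NormedAddCommGroup EM] [NormedSpace ℝ EM]
  {M : Type*} [TopologicalSpace M] [ChartedSpace EM M] [IsManifold 𝓘(ℝ, EM) ∞ M]
  {F : Type*} [NormedAddCommGroup F] [NormedSpace ℝ F]
  {E : M → Type*} [TopologicalSpace (Bundle.TotalSpace F E)] [∀ x, TopologicalSpace (E x)]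
  [∀ x, AddCommGroup (E x)] [∀ x, Module ℝ (E x)] [FiberBundle F E] [VectorBundle ℝ F E]
  {𝕜 : Type*} [RCLike 𝕜] {V : Type*} [AddCommGroup V] [Module ℝ V] {k : ℕ}

universe uι

/-- A spin structure on `(E, ⟨ , ⟩)`: isometric trivialisations `V × U i ≅ E|_{U i}` over an open
cover of `M`, and a smooth lift of their transition maps to a `Pin(V)`-valued cocycle. The
trivialisation over `U i` sends `v` to the restriction of a global section `frame i v` (every
cover by trivialisations has a refinement with this property). -/
structure PinStructure (C : CourantAlgebroid EM F E) (m : SpinorModel 𝕜 V k) where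
  Idx : Type uι
  U : Idx → Set M
  isOpen_U : ∀ i, IsOpen (U i)
  cover : ∀ x, ∃ i, x ∈ U i
  frame : Idx → V →ₗ[ℝ] Cₛ^∞⟮𝓘(ℝ, EM); F, E⟯
  frame_form : ∀ i, ∀ x ∈ U i, ∀ v w, C.pairing x (frame i v x) (frame i w x) = m.form v w
  frame_surjective : ∀ i, ∀ x ∈ U i, ∀ u : E x, ∃ v, frame i v x = u
  trans : Idx → Idx → M → m.Clˣ
  trans_mem : ∀ i j, ∀ x ∈ U i ∩ U j, trans i j x ∈ m.Pin
  trans_smooth : ∀ i j (l : m.Cl →ₗ[ℝ] ℝ),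
    ContMDiffOn 𝓘(ℝ, EM) 𝓘(ℝ, ℝ) ∞ (fun x ↦ l (trans i j x : m.Cl)) (U i ∩ U j)
  trans_frame : ∀ i j, ∀ x ∈ U i ∩ U j, ∀ v w, frame i v x = frame j w x →
    CliffordAlgebra.ι m.quad v =
      (trans i j x : m.Cl) * CliffordAlgebra.ι m.quad w * ((trans i j x)⁻¹ : m.Clˣ)
  cocycle : ∀ i j l, ∀ x ∈ U i ∩ U j ∩ U l, trans i j x * trans j l x = trans i l x

/-- A smooth section of the spinor bundle associated to a spin structure, given by its local
representatives. -/
structure SpinorField {C : CourantAlgebroid EM F E} {m : SpinorModel 𝕜 V k}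
    (P : PinStructure.{uι} C m) where
  rep : P.Idx → M → SpinorSpace 𝕜 k
  smooth : ∀ i (l : SpinorSpace 𝕜 k →ₗ[ℝ] ℝ),
    ContMDiffOn 𝓘(ℝ, EM) 𝓘(ℝ, ℝ) ∞ (fun x ↦ l (rep i x)) (P.U i)
  compat : ∀ i j, ∀ x ∈ P.U i ∩ P.U j, rep i x = m.act (P.trans i j x : m.Cl) (rep j x)

/-- The derivative of a spinor-valued function along a tangent vector. -/
def spinorDeriv {x : M} (X : TangentSpace 𝓘(ℝ, EM) x) (A : M → SpinorSpace 𝕜 k) :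
    SpinorSpace 𝕜 k :=
  ∑ i, dirDeriv X (fun y ↦ (Module.finBasis ℝ (SpinorSpace 𝕜 k)).repr (A y) i) •
    Module.finBasis ℝ (SpinorSpace 𝕜 k) i

/-- The generating Dirac operator
`D_div = e^α (ρ(e_α) + (1/2) div e_α) - (1/6) e^α e^β e^γ c_{αβγ}`, `c_{αβγ} = ⟨[e_α, e_β], e_γ⟩`,
applied to a spinor field, at `x` in the trivialisation `i`; `e_α` is (the frame of `E` given by)
a basis of `V` and `e^α` is the dual basis. -/
def diracOp [FiniteDimensional ℝ V] {C : CourantAlgebroid EM F E} {m : SpinorModel 𝕜 V k}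
    {P : PinStructure.{uι} C m} (div : Divergence C) (A : SpinorField P) (i : P.Idx) (x : M) :
    SpinorSpace 𝕜 k :=
  let e := Module.finBasis ℝ V
  let e' := m.form.dualBasis m.form_nondegenerate e
  (∑ α, m.gamma (e' α) (spinorDeriv (C.anchor x (P.frame i (e α) x)) (A.rep i) +
      ((1 / 2 : ℝ) * div.toFun (P.frame i (e α)) x) • A.rep i x)) -
    (1 / 6 : ℝ) • ∑ α, ∑ β, ∑ γ,
      C.pairing x (C.bracket (P.frame i (e α)) (P.frame i (e β)) x) (P.frame i (e γ) x) •
        m.gamma (e' α) (m.gamma (e' β) (m.gamma (e' γ) (A.rep i x)))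

/-- The number `ν`: it is `1` for even spinors (type IIA) and `i` for odd ones (type IIB). -/
def nu (p : ZMod 2) : ℂ := if p = 0 then 1 else Complex.I

/-- `(V₊ ⊂ E, div, A)`, with `A` of parity `p`, solves the generalized type II SUGRA equations.
A vector of `E_x` is multiplied with a spinor through any trivialisation around `x`. -/
structure IsSUGRASolution [FiniteDimensional ℝ EM] [T2Space M]
    [ContMDiffVectorBundle ∞ F E 𝓘(ℝ, EM)] [FiniteDimensional ℝ V]
    {C : CourantAlgebroid EM F E} {m : SpinorModel 𝕜 V k} {P : PinStructure.{uι} C m} {n : ℕ}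
    (Vp : LorentzianPseudometric C n) (div : Divergence C) (A : SpinorField P) (p : ZMod 2) :
    Prop where
  parity : ∀ i, ∀ x ∈ P.U i,
    A.rep i x ∈ CliffordAlgebra.evenOdd (0 : QuadraticForm 𝕜 (Fin k → 𝕜)) p
  /-- `R_{V₊} A = A`, where `R_{V₊} = 2^{n/2} e₁ ⋯ e_n` for an oriented pseudo-orthonormal basis
  of `V₊`. -/
  self_dual : ∀ i, ∀ x ∈ P.U i, ∀ v : Fin n → V,
    IsOrientedOrthonormal (C.pairing x) (Vp.plus x) (Vp.orient x) Vp.sign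
      (fun a ↦ P.frame i (v a) x) →
    (Real.sqrt 2 ^ n) •
      m.act (List.ofFn fun a ↦ CliffordAlgebra.ι m.quad (v a)).prod (A.rep i x) = A.rep i x
  dirac : ∀ i, ∀ x ∈ P.U i, diracOp div A i x = 0
  ricci : ∀ a b : Cₛ^∞⟮𝓘(ℝ, EM); F, E⟯, (∀ x, a x ∈ Vp.plus x) → (∀ x, b x ∈ Vp.minus x) →
    ∀ i, ∀ x ∈ P.U i, ∀ v w : V, P.frame i v x = a x → P.frame i w x = b x →
      (Vp.gRic div a b x : ℂ) = Complex.I / (8 * nu p) *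
        spinorPairing 𝕜 k (m.gamma v (A.rep i x)) (m.gamma w (A.rep i x))
  scalar : ∀ x, Vp.HasScalarCurvatureAt div x 0

variable {EM' : Type*} [NormedAddCommGroup EM'] [NormedSpace ℝ EM']
  {M' : Type*} [TopologicalSpace M'] [ChartedSpace EM' M'] [IsManifold 𝓘(ℝ, EM') ∞ M']
  {τ : C^∞⟮𝓘(ℝ, EM'), M'; 𝓘(ℝ, EM), M⟯} {C : CourantAlgebroid EM F E}
  {C' : CourantAlgebroid EM' F ((τ : M' → M) *ᵖ E)} {m : SpinorModel 𝕜 V k}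

/-- The pullback of a spin structure. -/
def PinStructure.pullback (P : PinStructure.{uι} C m) (h : IsCAPullback C τ C') :
    PinStructure.{uι} C' m where
  Idx := P.Idx
  U i := τ ⁻¹' P.U i
  isOpen_U i := (P.isOpen_U i).preimage τ.contMDiff.continuous
  cover x := P.cover (τ x)
  frame i :=
    { toFun := fun v ↦ pullSection τ (P.frame i v)
      map_add' := fun v w ↦ by rw [map_add]; rfl
      map_smul' := fun c v ↦ by rw [map_smul]; rfl }
  frame_form i x hx v w :=
    (h.pairing_eq (P.frame i v) (P.frame i w) x).trans (P.frame_form i (τ x) hx v w)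
  frame_surjective i x hx u := P.frame_surjective i (τ x) hx u
  trans i j x := P.trans i j (τ x)
  trans_mem i j x hx := P.trans_mem i j (τ x) hx
  trans_smooth i j l :=
    (P.trans_smooth i j l).comp τ.contMDiff.contMDiffOn fun _ hx ↦ hx
  trans_frame i j x hx v w hvw := P.trans_frame i j (τ x) hx v w hvw
  cocycle i j l x hx := P.cocycle i j l (τ x) hx

/-- The pullback `τ^* A` of a spinor field. -/
def SpinorField.pullback {P : PinStructure.{uι} C m} (A : SpinorField P)
    (h : IsCAPullback C τ C') : SpinorField (P.pullback h) where
  rep i x := A.rep i (τ x)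
  smooth i l := (A.smooth i l).comp τ.contMDiff.contMDiffOn fun _ hx ↦ hx
  compat i j x hx := A.compat i j (τ x) hx

end Spin

end

/-! Every ingredient of the equations is built from the pairing, the bracket, the anchor and the
divergence. On pulled-back sections each of these is the pullback of its counterpart on $E$; for
derivatives this is the chain rule with $\tau_*\rho'(\tau^*u)=\rho(u)$
(`IsCAPullback.dirDeriv_comp`). Pulled-back sections span every fibre of $E'$, but a general section
of $E'$ is only locally a combination $\sum_\alpha f_\alpha\,\tau^*e_\alpha$ with coefficients
$f_\alpha$ on $M'$. The content of the proof is the control of these coefficients.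

Divergence. Leibniz forces $\mathrm{div}'(\sum
f_\alpha\tau^*e_\alpha)=\sum\bigl(f_\alpha\,\tau^*\mathrm{div}\,e_\alpha+\rho'(\tau^*e_\alpha)f_\alpha\bigr)$.
The right side, `Divergence.localPullback`, obeys the Leibniz rule and has the right values on
pulled-back sections. The difference of two maps with the same Leibniz rule is tensorial, so it
vanishes once it vanishes on pulled-back sections (`Divergence.eq_of_forall_pullSection`). This one
argument gives both the gluing of the local formulas and the uniqueness.

Equations. Parity and $R_{V_+}F=F$ are pointwise conditions, and the fibres with their forms
coincide. The Dirac operator and the scalar curvature are evaluated in a single frame, and the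
pulled-back frame serves (`diracOp_pullback`, `HasScalarCurvatureAt.pullback`). The Ricci equation
is demanded for all sections of $\tau^*V_\pm$, so it needs $\mathrm{GRic}$ to be tensorial in both
arguments (`gRic_congr`): the derivatives of $f$ produced by the divergence terms and by the trace
cancel, in the first argument because the anchor preserves brackets (`lieDeriv_bracket`). The
arguments can then be replaced at each point by pulled-back sections. -/

noncomputable section

set_option linter.unusedSectionVars false

/-! ### Directional derivatives and cutoff functions -/

section DirDeriv

variable {EM : Type*} [NormedAddCommGroup EM] [NormedSpace ℝ EM]
  {M : Type*} [TopologicalSpace M] [ChartedSpace EM M]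
  {EM' : Type*} [NormedAddCommGroup EM'] [NormedSpace ℝ EM']
  {M' : Type*} [TopologicalSpace M'] [ChartedSpace EM' M']

theorem dirDeriv_congr {x : M} (X : TangentSpace 𝓘(ℝ, EM) x) {f g : M → ℝ} (h : f =ᶠ[𝓝 x] g) :
    dirDeriv X f = dirDeriv X g := by
  unfold dirDeriv
  rw [h.mfderiv_eq]
  rfl

theorem dirDeriv_add_left {x : M} (X Y : TangentSpace 𝓘(ℝ, EM) x) (f : M → ℝ) :
    dirDeriv (X + Y) f = dirDeriv X f + dirDeriv Y f :=
  map_add (mfderiv 𝓘(ℝ, EM) 𝓘(ℝ, ℝ) f x) X Y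

theorem dirDeriv_smul_left {x : M} (c : ℝ) (X : TangentSpace 𝓘(ℝ, EM) x) (f : M → ℝ) :
    dirDeriv (c • X) f = c * dirDeriv X f :=
  map_smul (mfderiv 𝓘(ℝ, EM) 𝓘(ℝ, ℝ) f x) c X

theorem dirDeriv_zero_left {x : M} (f : M → ℝ) :
    dirDeriv (0 : TangentSpace 𝓘(ℝ, EM) x) f = 0 :=
  map_zero (mfderiv 𝓘(ℝ, EM) 𝓘(ℝ, ℝ) f x)

/-- The derivative along `A w`, as a linear form in `w`, for a linear map `A` into a tangent
space. -/
def dirDerivForm {x : M} {W : Type*} [AddCommGroup W] [Module ℝ W]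
    (A : W →ₗ[ℝ] TangentSpace 𝓘(ℝ, EM) x) (f : M → ℝ) : W →ₗ[ℝ] ℝ where
  toFun w := dirDeriv (A w) f
  map_add' v w := by rw [map_add, dirDeriv_add_left]
  map_smul' c v := by rw [map_smul, dirDeriv_smul_left]; rfl

theorem dirDeriv_const {x : M} (X : TangentSpace 𝓘(ℝ, EM) x) (c : ℝ) :
    dirDeriv X (fun _ ↦ c) = 0 := by
  unfold dirDeriv
  rw [mfderiv_const]
  rfl

theorem dirDeriv_add {x : M} (X : TangentSpace 𝓘(ℝ, EM) x) {f g : M → ℝ}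
    (hf : MDifferentiableAt 𝓘(ℝ, EM) 𝓘(ℝ, ℝ) f x) (hg : MDifferentiableAt 𝓘(ℝ, EM) 𝓘(ℝ, ℝ) g x) :
    dirDeriv X (f + g) = dirDeriv X f + dirDeriv X g := by
  unfold dirDeriv
  rw [mfderiv_add hf hg]
  rfl

theorem dirDeriv_const_smul {x : M} (X : TangentSpace 𝓘(ℝ, EM) x) {f : M → ℝ}
    (hf : MDifferentiableAt 𝓘(ℝ, EM) 𝓘(ℝ, ℝ) f x) (c : ℝ) :
    dirDeriv X (c • f) = c * dirDeriv X f := by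
  unfold dirDeriv
  rw [const_smul_mfderiv hf]
  rfl

theorem dirDeriv_mul {x : M} (X : TangentSpace 𝓘(ℝ, EM) x) {f g : M → ℝ}
    (hf : MDifferentiableAt 𝓘(ℝ, EM) 𝓘(ℝ, ℝ) f x) (hg : MDifferentiableAt 𝓘(ℝ, EM) 𝓘(ℝ, ℝ) g x) :
    dirDeriv X (f * g) = f x * dirDeriv X g + g x * dirDeriv X f := by
  unfold dirDeriv
  rw [(hf.hasMFDerivAt.mul hg.hasMFDerivAt).mfderiv]
  rfl

theorem dirDeriv_comp (τ : C^∞⟮𝓘(ℝ, EM'), M'; 𝓘(ℝ, EM), M⟯) {x : M'}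
    (X : TangentSpace 𝓘(ℝ, EM') x) {f : M → ℝ}
    (hf : MDifferentiableAt 𝓘(ℝ, EM) 𝓘(ℝ, ℝ) f (τ x)) :
    dirDeriv X (fun y ↦ f (τ y)) = dirDeriv (mfderiv 𝓘(ℝ, EM') 𝓘(ℝ, EM) τ x X) f := by
  have h : MDifferentiableAt 𝓘(ℝ, EM') 𝓘(ℝ, EM) τ x :=
    (τ.contMDiff x).mdifferentiableAt (by simp)
  unfold dirDeriv
  change mfderiv 𝓘(ℝ, EM') 𝓘(ℝ, ℝ) (f ∘ τ) x X = _
  rw [mfderiv_comp x hf h]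
  rfl

theorem ContMDiffMap.mdifferentiableAt_real (f : C^∞⟮𝓘(ℝ, EM), M; ℝ⟯) (x : M) :
    MDifferentiableAt 𝓘(ℝ, EM) 𝓘(ℝ, ℝ) f x :=
  (f.contMDiff x).mdifferentiableAt (by simp)

/-- A smooth function which is `1` near `x` and vanishes off the open set `U`. -/
theorem exists_contMDiffMap_eq_one [FiniteDimensional ℝ EM] [T2Space M]
    [IsManifold 𝓘(ℝ, EM) ∞ M] {U : Set M} (hU : IsOpen U) {x : M} (hx : x ∈ U) :
    ∃ ψ : C^∞⟮𝓘(ℝ, EM), M; ℝ⟯, (∀ᶠ y in 𝓝 x, ψ y = 1) ∧ ∀ y ∉ U, ψ y = 0 := by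
  obtain ⟨ψ, -, hψ⟩ :=
    (SmoothBumpFunction.nhds_basis_tsupport (I := 𝓘(ℝ, EM)) x).mem_iff.1 (hU.mem_nhds hx)
  refine ⟨⟨ψ, ψ.contMDiff⟩, ψ.eventuallyEq_one, fun y hy ↦ ?_⟩
  exact image_eq_zero_of_notMem_tsupport fun h ↦ hy (hψ h)

end DirDeriv

/-! ### Locality of maps on smooth sections -/

section Functionals

variable {EM : Type*} [NormedAddCommGroup EM] [NormedSpace ℝ EM]
  {M : Type*} [TopologicalSpace M] [ChartedSpace EM M]
  {F : Type*} [NormedAddCommGroup F] [NormedSpace ℝ F]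
  {E : M → Type*} [TopologicalSpace (Bundle.TotalSpace F E)] [∀ x, TopologicalSpace (E x)]
  [∀ x, AddCommGroup (E x)] [∀ x, Module ℝ (E x)] [FiberBundle F E] [VectorBundle ℝ F E]

@[simp]
theorem smulSection_apply (f : C^∞⟮𝓘(ℝ, EM), M; ℝ⟯) (s : Cₛ^∞⟮𝓘(ℝ, EM); F, E⟯) (x : M) :
    smulSection f s x = f x • s x :=
  rfl

theorem ContMDiffSection.sum_apply {ι : Type*} (t : Finset ι) (s : ι → Cₛ^∞⟮𝓘(ℝ, EM); F, E⟯)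
    (x : M) : (∑ a ∈ t, s a) x = ∑ a ∈ t, s a x :=
  map_sum (evalSection x) s t

/-- A map on smooth sections that does not change when a section is multiplied with a function
which is `1` near `x` only depends on the germ of the section at `x`. -/
theorem eq_of_eventuallyEq_of_leibniz [FiniteDimensional ℝ EM] [T2Space M]
    [IsManifold 𝓘(ℝ, EM) ∞ M] {W : Type*} {x : M}
    (φ : Cₛ^∞⟮𝓘(ℝ, EM); F, E⟯ → W)
    (h : ∀ (f : C^∞⟮𝓘(ℝ, EM), M; ℝ⟯) s, (∀ᶠ y in 𝓝 x, f y = 1) → φ (smulSection f s) = φ s)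
    {s t : Cₛ^∞⟮𝓘(ℝ, EM); F, E⟯} (hst : ∀ᶠ y in 𝓝 x, s y = t y) : φ s = φ t := by
  obtain ⟨U, hU, hUo, hxU⟩ := mem_nhds_iff.1 hst
  -- The cutoff vanishes wherever `s` and `t` may differ, so `ψ s = ψ t` globally.
  obtain ⟨ψ, hψ, hψ0⟩ := exists_contMDiffMap_eq_one (EM := EM) hUo hxU
  rw [← h ψ s hψ, ← h ψ t hψ]
  congr 1
  ext y
  by_cases hy : y ∈ U
  · have : s y = t y := hU hy
    simp [this]
  · simp [hψ0 y hy]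

end Functionals

/-! ### Calculus in a Courant algebroid -/

namespace CourantAlgebroid

variable {EM : Type*} [NormedAddCommGroup EM] [NormedSpace ℝ EM]
  {M : Type*} [TopologicalSpace M] [ChartedSpace EM M] [IsManifold 𝓘(ℝ, EM) ∞ M]
  {F : Type*} [NormedAddCommGroup F] [NormedSpace ℝ F]
  {E : M → Type*} [TopologicalSpace (Bundle.TotalSpace F E)] [∀ x, TopologicalSpace (E x)]
  [∀ x, AddCommGroup (E x)] [∀ x, Module ℝ (E x)] [FiberBundle F E] [VectorBundle ℝ F E]
  (C : CourantAlgebroid EM F E)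

/-- The smooth function `⟨u, v⟩`. -/
def pairingFun (u v : Cₛ^∞⟮𝓘(ℝ, EM); F, E⟯) : C^∞⟮𝓘(ℝ, EM), M; ℝ⟯ :=
  ⟨fun x ↦ C.pairing x (u x) (v x), C.pairing_smooth u v⟩

@[simp]
theorem pairingFun_apply (u v : Cₛ^∞⟮𝓘(ℝ, EM); F, E⟯) (x : M) :
    C.pairingFun u v x = C.pairing x (u x) (v x) :=
  rfl

/-- The smooth function `u · f = ρ(u) f`. -/
def lieDeriv (u : Cₛ^∞⟮𝓘(ℝ, EM); F, E⟯) (f : C^∞⟮𝓘(ℝ, EM), M; ℝ⟯) :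
    C^∞⟮𝓘(ℝ, EM), M; ℝ⟯ where
  val x := dirDeriv (C.anchor x (u x)) f
  property := by
    -- The function is the fibre component of the tangent map of `f` along the smooth vector field
    -- `ρ(u)`.
    have h1 : ContMDiff 𝓘(ℝ, EM).tangent 𝓘(ℝ, ℝ).tangent ∞
        (tangentMap 𝓘(ℝ, EM) 𝓘(ℝ, ℝ) f) :=
      f.contMDiff.contMDiff_tangentMap (by simp)
    exact ((contMDiff_snd_tangentBundle_modelSpace ℝ 𝓘(ℝ, ℝ)).comp h1).comp (C.anchor_smooth u)

@[simp]
theorem lieDeriv_apply (u : Cₛ^∞⟮𝓘(ℝ, EM); F, E⟯) (f : C^∞⟮𝓘(ℝ, EM), M; ℝ⟯) (x : M) :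
    C.lieDeriv u f x = dirDeriv (C.anchor x (u x)) f :=
  rfl

theorem bracket_smulSection (u v : Cₛ^∞⟮𝓘(ℝ, EM); F, E⟯) (f : C^∞⟮𝓘(ℝ, EM), M; ℝ⟯) :
    C.bracket u (smulSection f v) =
      smulSection f (C.bracket u v) + smulSection (C.lieDeriv u f) v := by
  ext x
  exact C.leibniz u v f x

theorem eq_of_forall_pairing {x : M} {u v : E x} (h : ∀ w, C.pairing x w u = C.pairing x w v) :
    u = v := by
  refine sub_eq_zero.1 ((C.pairing_nondegenerate x).2 _ fun w ↦ ?_)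
  rw [map_sub, h, sub_self]

/-- The symmetric part of the bracket is $d_E\langle u,v\rangle$, which is zero for orthogonal
sections. This applies to pairs from $V_+$ and $V_-$. -/
theorem bracket_swap_of_pairing_eq_zero {u v : Cₛ^∞⟮𝓘(ℝ, EM); F, E⟯}
    (h : ∀ x, C.pairing x (u x) (v x) = 0) : C.bracket u v = -C.bracket v u := by
  ext x
  refine eq_neg_of_add_eq_zero_left (C.eq_of_forall_pairing fun w ↦ ?_)
  rw [C.bracket_add_swap, map_zero]
  simp only [h]
  exact dirDeriv_const _ 0

theorem smulSection_bracket_of_pairing_eq_zero {u v : Cₛ^∞⟮𝓘(ℝ, EM); F, E⟯}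
    (h : ∀ x, C.pairing x (u x) (v x) = 0) (f : C^∞⟮𝓘(ℝ, EM), M; ℝ⟯) :
    C.bracket (smulSection f u) v =
      smulSection f (C.bracket u v) - smulSection (C.lieDeriv v f) u := by
  have h' : ∀ x, C.pairing x (v x) (u x) = 0 := fun x ↦ (C.pairing_symm x _ _).trans (h x)
  rw [C.bracket_swap_of_pairing_eq_zero, C.bracket_smulSection,
    C.bracket_swap_of_pairing_eq_zero h']
  · ext x
    change -(f x • -C.bracket u v x + C.lieDeriv v f x • u x) =
      f x • C.bracket u v x - C.lieDeriv v f x • u x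
    module
  · intro x
    simp [h]

/-- The anchor is a homomorphism: `[u, v] · f = u · (v · f) - v · (u · f)`. -/
theorem lieDeriv_bracket (u v : Cₛ^∞⟮𝓘(ℝ, EM); F, E⟯) (f : C^∞⟮𝓘(ℝ, EM), M; ℝ⟯) (x : M) :
    C.lieDeriv (C.bracket u v) f x =
      C.lieDeriv u (C.lieDeriv v f) x - C.lieDeriv v (C.lieDeriv u f) x := by
  -- Expand the Jacobi identity for $u,v,fw$ by Leibniz and subtract $f$ times the one for $u,v,w$:
  -- the mixed first-order terms cancel and the defect multiplies $w$.
  have key : ∀ w : Cₛ^∞⟮𝓘(ℝ, EM); F, E⟯, (C.lieDeriv (C.bracket u v) f x -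
      (C.lieDeriv u (C.lieDeriv v f) x - C.lieDeriv v (C.lieDeriv u f) x)) • w x = 0 := by
    intro w
    have h := congrArg (fun s ↦ s x) (C.jacobi u v (smulSection f w))
    simp only [C.bracket_smulSection, map_add] at h
    have h2 := congrArg (fun s ↦ s x) (C.jacobi u v w)
    simp only [ContMDiffSection.coe_add, Pi.add_apply, smulSection_apply] at h h2
    rw [h2] at h
    linear_combination (norm := module) (-1 : ℝ) • h
  -- Some `w` with `w x ≠ 0` is needed. If none of `u`, `v`, `[u, v]` qualifies, all three vanish at
  -- `x` and so do all terms of the identity.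
  by_cases hu : u x = 0
  · by_cases hb : C.bracket u v x = 0
    · by_cases hv : v x = 0
      · simp [hu, hv, hb, dirDeriv_zero_left]
      · exact sub_eq_zero.1 ((smul_eq_zero.1 (key v)).resolve_right hv)
    · exact sub_eq_zero.1 ((smul_eq_zero.1 (key _)).resolve_right hb)
  · exact sub_eq_zero.1 ((smul_eq_zero.1 (key u)).resolve_right hu)

end CourantAlgebroid

/-! ### Local frames from the spin structure; tensorial maps -/

namespace PinStructure

universe uι

variable {EM : Type*} [NormedAddCommGroup EM] [NormedSpace ℝ EM]
  {M : Type*} [TopologicalSpace M] [ChartedSpace EM M] [IsManifold 𝓘(ℝ, EM) ∞ M]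
  {F : Type*} [NormedAddCommGroup F] [NormedSpace ℝ F]
  {E : M → Type*} [TopologicalSpace (Bundle.TotalSpace F E)] [∀ x, TopologicalSpace (E x)]
  [∀ x, AddCommGroup (E x)] [∀ x, Module ℝ (E x)] [FiberBundle F E] [VectorBundle ℝ F E]
  {𝕜 : Type*} [RCLike 𝕜] {V : Type*} [AddCommGroup V] [Module ℝ V] {k : ℕ}
  {C : CourantAlgebroid EM F E} {m : SpinorModel 𝕜 V k} [FiniteDimensional ℝ V]
  (P : PinStructure.{uι} C m)

include P in
theorem finite_fibre (x : M) : Module.Finite ℝ (E x) := by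
  obtain ⟨i, hi⟩ := P.cover x
  exact Module.Finite.of_surjective (evalSection x ∘ₗ P.frame i) (P.frame_surjective i x hi)

/-- The frame over `U i` given by a basis of `V`. -/
def basisFrame (i : P.Idx) (α : Fin (Module.finrank ℝ V)) : Cₛ^∞⟮𝓘(ℝ, EM); F, E⟯ :=
  P.frame i (Module.finBasis ℝ V α)

/-- The coefficient of a section with respect to `basisFrame`. -/
def coeff (i : P.Idx) (s : Cₛ^∞⟮𝓘(ℝ, EM); F, E⟯) (α : Fin (Module.finrank ℝ V)) :
    C^∞⟮𝓘(ℝ, EM), M; ℝ⟯ :=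
  C.pairingFun (P.frame i (m.form.dualBasis m.form_nondegenerate (Module.finBasis ℝ V) α)) s

/-- The trivialization is isometric over `U i`, so pairing with the dual frame reads off coordinates
there. The functions `coeff` are smooth on all of `M`, but have this meaning only over `U i`. -/
theorem sum_coeff {i : P.Idx} {x : M} (hx : x ∈ P.U i) (s : Cₛ^∞⟮𝓘(ℝ, EM); F, E⟯) :
    ∑ α, P.coeff i s α x • P.basisFrame i α x = s x := by
  obtain ⟨v, hv⟩ := P.frame_surjective i x hx (s x)
  have h : ∀ α, P.coeff i s α x = (Module.finBasis ℝ V).repr v α := by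
    intro α
    rw [coeff, CourantAlgebroid.pairingFun_apply, ← hv, P.frame_form i x hx]
    conv_lhs => rw [← (Module.finBasis ℝ V).sum_repr v]
    simp [LinearMap.BilinForm.apply_dualBasis_left, -Module.Basis.sum_repr]
  rw [← hv]
  conv_rhs => rw [← (Module.finBasis ℝ V).sum_repr v]
  simp only [h]
  change _ = (evalSection x ∘ₗ P.frame i) _
  rw [map_sum]
  simp only [map_smul]
  rfl

section Tensorial

variable [FiniteDimensional ℝ EM] [T2Space M] {W : Type*} [AddCommGroup W] [Module ℝ W] {x : M}

/-- The frame expansion of `s` is valid only over `U i`; since `φ` sees only the germ at `x`, the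
globally defined sum may replace `s`. -/
theorem apply_eq_sum_of_tensorial {i : P.Idx} (hx : x ∈ P.U i)
    (φ : Cₛ^∞⟮𝓘(ℝ, EM); F, E⟯ →+ W)
    (h : ∀ (f : C^∞⟮𝓘(ℝ, EM), M; ℝ⟯) s, φ (smulSection f s) = f x • φ s)
    (s : Cₛ^∞⟮𝓘(ℝ, EM); F, E⟯) :
    φ s = ∑ α, P.coeff i s α x • φ (P.basisFrame i α) := by
  rw [eq_of_eventuallyEq_of_leibniz (x := x) φ (t := ∑ α, smulSection (P.coeff i s α)
    (P.basisFrame i α))]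
  · rw [map_sum]
    simp only [h]
  · intro f s hf
    rw [h, hf.self_of_nhds, one_smul]
  · filter_upwards [(P.isOpen_U i).mem_nhds hx] with y hy
    rw [ContMDiffSection.sum_apply, ← P.sum_coeff hy s]
    rfl

include P in
/-- A tensorial map on sections only depends on the value of the section at the point. -/
theorem apply_eq_of_tensorial (φ : Cₛ^∞⟮𝓘(ℝ, EM); F, E⟯ →+ W)
    (h : ∀ (f : C^∞⟮𝓘(ℝ, EM), M; ℝ⟯) s, φ (smulSection f s) = f x • φ s)
    {s t : Cₛ^∞⟮𝓘(ℝ, EM); F, E⟯} (hst : s x = t x) : φ s = φ t := by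
  obtain ⟨i, hi⟩ := P.cover x
  rw [P.apply_eq_sum_of_tensorial hi φ h s, P.apply_eq_sum_of_tensorial hi φ h t]
  simp only [coeff, CourantAlgebroid.pairingFun_apply, hst]

end Tensorial

end PinStructure

/-! ### Projections to $V_\pm$ and Leibniz rules for projected brackets -/

namespace LorentzianPseudometric

variable {EM : Type*} [NormedAddCommGroup EM] [NormedSpace ℝ EM]
  {M : Type*} [TopologicalSpace M] [ChartedSpace EM M] [IsManifold 𝓘(ℝ, EM) ∞ M]
  {F : Type*} [NormedAddCommGroup F] [NormedSpace ℝ F]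
  {E : M → Type*} [TopologicalSpace (Bundle.TotalSpace F E)] [∀ x, TopologicalSpace (E x)]
  [∀ x, AddCommGroup (E x)] [∀ x, Module ℝ (E x)] [FiberBundle F E] [VectorBundle ℝ F E]
  {C : CourantAlgebroid EM F E} {n : ℕ} (V : LorentzianPseudometric C n)

@[simp]
theorem projPlus_apply (s : Cₛ^∞⟮𝓘(ℝ, EM); F, E⟯) (x : M) : V.projPlus s x = V.proj x (s x) :=
  rfl

@[simp]
theorem projMinus_apply (s : Cₛ^∞⟮𝓘(ℝ, EM); F, E⟯) (x : M) :
    V.projMinus s x = s x - V.proj x (s x) :=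
  rfl

theorem proj_unique {x : M} {w p : E x} (hp : p ∈ V.plus x)
    (h : ∀ v ∈ V.plus x, C.pairing x v p = C.pairing x v w) : p = V.proj x w :=
  (Classical.choose_spec (V.exists_frame x)).self_of_nhds.frameProj_unique w p hp h

theorem proj_eq_self {x : M} {v : E x} (hv : v ∈ V.plus x) : V.proj x v = v :=
  (V.proj_unique hv fun _ _ ↦ rfl).symm

theorem proj_eq_zero {x : M} {w : E x} (hw : w ∈ V.minus x) : V.proj x w = 0 :=
  (V.proj_unique (V.plus x).zero_mem fun v hv ↦ by rw [map_zero, hw v hv]).symm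

theorem sub_proj_mem_minus (x : M) (w : E x) : w - V.proj x w ∈ V.minus x := fun v hv ↦ by
  rw [map_sub, V.pairing_proj x w v hv, sub_self]

theorem pairing_eq_zero {x : M} {v w : E x} (hv : v ∈ V.plus x) (hw : w ∈ V.minus x) :
    C.pairing x v w = 0 :=
  hw v hv

theorem pairing_eq_zero' {x : M} {v w : E x} (hv : v ∈ V.plus x) (hw : w ∈ V.minus x) :
    C.pairing x w v = 0 :=
  (C.pairing_symm x w v).trans (hw v hv)

theorem projPlus_smulSection (f : C^∞⟮𝓘(ℝ, EM), M; ℝ⟯) (s : Cₛ^∞⟮𝓘(ℝ, EM); F, E⟯) :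
    V.projPlus (smulSection f s) = smulSection f (V.projPlus s) := by
  ext x
  simp

theorem projMinus_smulSection (f : C^∞⟮𝓘(ℝ, EM), M; ℝ⟯) (s : Cₛ^∞⟮𝓘(ℝ, EM); F, E⟯) :
    V.projMinus (smulSection f s) = smulSection f (V.projMinus s) := by
  ext x
  simp [smul_sub]

theorem projPlus_eq_self {a : Cₛ^∞⟮𝓘(ℝ, EM); F, E⟯} (ha : ∀ x, a x ∈ V.plus x) :
    V.projPlus a = a := by
  ext x
  simp [V.proj_eq_self (ha x)]

theorem projMinus_eq_self {b : Cₛ^∞⟮𝓘(ℝ, EM); F, E⟯} (hb : ∀ x, b x ∈ V.minus x) :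
    V.projMinus b = b := by
  ext x
  simp [V.proj_eq_zero (hb x)]

theorem projPlus_eq_zero {b : Cₛ^∞⟮𝓘(ℝ, EM); F, E⟯} (hb : ∀ x, b x ∈ V.minus x) :
    V.projPlus b = 0 := by
  ext x
  simp [V.proj_eq_zero (hb x)]

theorem projMinus_eq_zero {a : Cₛ^∞⟮𝓘(ℝ, EM); F, E⟯} (ha : ∀ x, a x ∈ V.plus x) :
    V.projMinus a = 0 := by
  ext x
  simp [V.proj_eq_self (ha x)]

/-- The map `w ↦ [w₊, b]₋` on sections. -/
def bracketMinus (b : Cₛ^∞⟮𝓘(ℝ, EM); F, E⟯) :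
    Cₛ^∞⟮𝓘(ℝ, EM); F, E⟯ →ₗ[ℝ] Cₛ^∞⟮𝓘(ℝ, EM); F, E⟯ :=
  V.projMinus ∘ₗ C.bracket.flip b ∘ₗ V.projPlus

/-- The map `w ↦ [[w₊, b]₋, a]₊` on sections. -/
def bracketPlusMinus (a b : Cₛ^∞⟮𝓘(ℝ, EM); F, E⟯) :
    Cₛ^∞⟮𝓘(ℝ, EM); F, E⟯ →ₗ[ℝ] Cₛ^∞⟮𝓘(ℝ, EM); F, E⟯ :=
  V.projPlus ∘ₗ C.bracket.flip a ∘ₗ V.bracketMinus b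

theorem bracketMinus_apply (b s : Cₛ^∞⟮𝓘(ℝ, EM); F, E⟯) :
    V.bracketMinus b s = V.projMinus (C.bracket (V.projPlus s) b) :=
  rfl

theorem bracketPlusMinus_apply (a b s : Cₛ^∞⟮𝓘(ℝ, EM); F, E⟯) :
    V.bracketPlusMinus a b s = V.projPlus (C.bracket (V.bracketMinus b s) a) :=
  rfl

theorem bracketMinus_mem (b s : Cₛ^∞⟮𝓘(ℝ, EM); F, E⟯) (x : M) :
    V.bracketMinus b s x ∈ V.minus x :=
  V.sub_proj_mem_minus x _

/-- The derivative term of the Leibniz rule is a multiple of `b`, hence lies in $V_-$ and is killed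
by the projection. -/
theorem projPlus_bracket_smulSection_left {a b : Cₛ^∞⟮𝓘(ℝ, EM); F, E⟯}
    (ha : ∀ x, a x ∈ V.plus x) (hb : ∀ x, b x ∈ V.minus x) (f : C^∞⟮𝓘(ℝ, EM), M; ℝ⟯) :
    V.projPlus (C.bracket (smulSection f b) a) = smulSection f (V.projPlus (C.bracket b a)) := by
  rw [C.smulSection_bracket_of_pairing_eq_zero (fun x ↦ V.pairing_eq_zero' (ha x) (hb x)), map_sub,
    projPlus_smulSection, projPlus_smulSection, V.projPlus_eq_zero hb]
  ext x
  simp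

theorem projPlus_bracket_smulSection_right {a : Cₛ^∞⟮𝓘(ℝ, EM); F, E⟯}
    (ha : ∀ x, a x ∈ V.plus x) (b : Cₛ^∞⟮𝓘(ℝ, EM); F, E⟯) (f : C^∞⟮𝓘(ℝ, EM), M; ℝ⟯) :
    V.projPlus (C.bracket b (smulSection f a)) =
      smulSection f (V.projPlus (C.bracket b a)) + smulSection (C.lieDeriv b f) a := by
  rw [C.bracket_smulSection, map_add, projPlus_smulSection, projPlus_smulSection,
    V.projPlus_eq_self ha]

theorem bracketMinus_smulSection {b : Cₛ^∞⟮𝓘(ℝ, EM); F, E⟯} (hb : ∀ x, b x ∈ V.minus x)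
    (f : C^∞⟮𝓘(ℝ, EM), M; ℝ⟯) (s : Cₛ^∞⟮𝓘(ℝ, EM); F, E⟯) :
    V.bracketMinus b (smulSection f s) = smulSection f (V.bracketMinus b s) := by
  have h : ∀ x, V.projPlus s x ∈ V.plus x := fun x ↦ V.proj_mem x _
  simp only [bracketMinus_apply]
  rw [projPlus_smulSection, C.smulSection_bracket_of_pairing_eq_zero
    (fun x ↦ V.pairing_eq_zero (h x) (hb x)), map_sub, projMinus_smulSection,
    projMinus_smulSection, V.projMinus_eq_zero h]
  ext x
  simp

theorem bracketMinus_smulSection_left {b : Cₛ^∞⟮𝓘(ℝ, EM); F, E⟯} (hb : ∀ x, b x ∈ V.minus x)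
    (f : C^∞⟮𝓘(ℝ, EM), M; ℝ⟯) (s : Cₛ^∞⟮𝓘(ℝ, EM); F, E⟯) :
    V.bracketMinus (smulSection f b) s =
      smulSection f (V.bracketMinus b s) + smulSection (C.lieDeriv (V.projPlus s) f) b := by
  simp only [bracketMinus_apply]
  rw [C.bracket_smulSection, map_add, projMinus_smulSection, projMinus_smulSection,
    V.projMinus_eq_self hb]

theorem bracketPlusMinus_smulSection {a b : Cₛ^∞⟮𝓘(ℝ, EM); F, E⟯}
    (ha : ∀ x, a x ∈ V.plus x) (hb : ∀ x, b x ∈ V.minus x) (f : C^∞⟮𝓘(ℝ, EM), M; ℝ⟯)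
    (s : Cₛ^∞⟮𝓘(ℝ, EM); F, E⟯) :
    V.bracketPlusMinus a b (smulSection f s) = smulSection f (V.bracketPlusMinus a b s) := by
  simp only [bracketPlusMinus_apply]
  rw [V.bracketMinus_smulSection hb,
    V.projPlus_bracket_smulSection_left ha (V.bracketMinus_mem b s)]

theorem bracketPlusMinus_smulSection_left {a : Cₛ^∞⟮𝓘(ℝ, EM); F, E⟯}
    (ha : ∀ x, a x ∈ V.plus x) (b : Cₛ^∞⟮𝓘(ℝ, EM); F, E⟯) (f : C^∞⟮𝓘(ℝ, EM), M; ℝ⟯)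
    (s : Cₛ^∞⟮𝓘(ℝ, EM); F, E⟯) :
    V.bracketPlusMinus (smulSection f a) b s = smulSection f (V.bracketPlusMinus a b s) +
      smulSection (C.lieDeriv (V.bracketMinus b s) f) a := by
  simp only [bracketPlusMinus_apply]
  rw [V.projPlus_bracket_smulSection_right ha]

/-- The inner bracket contributes $(s_+\cdot f)\,b$; the outer one is tensorial in its $V_-$
argument, which turns this into a multiple of $[b,a]_+$. -/
theorem bracketPlusMinus_smulSection_right {a b : Cₛ^∞⟮𝓘(ℝ, EM); F, E⟯}
    (ha : ∀ x, a x ∈ V.plus x) (hb : ∀ x, b x ∈ V.minus x) (f : C^∞⟮𝓘(ℝ, EM), M; ℝ⟯)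
    (s : Cₛ^∞⟮𝓘(ℝ, EM); F, E⟯) :
    V.bracketPlusMinus a (smulSection f b) s = smulSection f (V.bracketPlusMinus a b s) +
      smulSection (C.lieDeriv (V.projPlus s) f) (V.projPlus (C.bracket b a)) := by
  simp only [bracketPlusMinus_apply]
  rw [V.bracketMinus_smulSection_left hb, map_add, LinearMap.add_apply, map_add,
    V.projPlus_bracket_smulSection_left ha (V.bracketMinus_mem b s),
    V.projPlus_bracket_smulSection_left ha hb]

end LorentzianPseudometric

/-! ### Tensoriality of the generalized Ricci tensor -/

namespace LorentzianPseudometric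

universe uι

variable {EM : Type*} [NormedAddCommGroup EM] [NormedSpace ℝ EM] [FiniteDimensional ℝ EM]
  {M : Type*} [TopologicalSpace M] [T2Space M] [ChartedSpace EM M] [IsManifold 𝓘(ℝ, EM) ∞ M]
  {F : Type*} [NormedAddCommGroup F] [NormedSpace ℝ F]
  {E : M → Type*} [TopologicalSpace (Bundle.TotalSpace F E)] [∀ x, TopologicalSpace (E x)]
  [∀ x, AddCommGroup (E x)] [∀ x, Module ℝ (E x)] [FiberBundle F E] [VectorBundle ℝ F E]
  [ContMDiffVectorBundle ∞ F E 𝓘(ℝ, EM)]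
  {𝕜 : Type*} [RCLike 𝕜] {W : Type*} [AddCommGroup W] [Module ℝ W] [FiniteDimensional ℝ W]
  {k : ℕ} {C : CourantAlgebroid EM F E} {m : SpinorModel 𝕜 W k} (P : PinStructure.{uι} C m)
  {n : ℕ} (V : LorentzianPseudometric C n)

/-- The endomorphism of `E_x` whose trace is `bracketTrace`. -/
def bracketEnd (a b : Cₛ^∞⟮𝓘(ℝ, EM); F, E⟯) (x : M) : E x →ₗ[ℝ] E x :=
  evalSection x ∘ₗ V.bracketPlusMinus a b ∘ₗ extendSection x

theorem bracketTrace_eq_trace (a b : Cₛ^∞⟮𝓘(ℝ, EM); F, E⟯) (x : M) :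
    V.bracketTrace a b x = LinearMap.trace ℝ (E x) (V.bracketEnd a b x) :=
  rfl

include P in
-- Tensoriality removes the dependence on the arbitrary extension chosen in `extendSection`.
theorem bracketEnd_apply {a b : Cₛ^∞⟮𝓘(ℝ, EM); F, E⟯} (ha : ∀ x, a x ∈ V.plus x)
    (hb : ∀ x, b x ∈ V.minus x) (s : Cₛ^∞⟮𝓘(ℝ, EM); F, E⟯) (x : M) :
    V.bracketEnd a b x (s x) = V.bracketPlusMinus a b s x := by
  refine P.apply_eq_of_tensorial (x := x)
    (evalSection x ∘ₗ V.bracketPlusMinus a b).toAddMonoidHom (fun f t ↦ ?_)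
    (extendSection_apply x (s x))
  change V.bracketPlusMinus a b (smulSection f t) x = f x • V.bracketPlusMinus a b t x
  rw [V.bracketPlusMinus_smulSection ha hb, smulSection_apply]

theorem bracketTrace_add_left (a a' b : Cₛ^∞⟮𝓘(ℝ, EM); F, E⟯) (x : M) :
    V.bracketTrace (a + a') b x = V.bracketTrace a b x + V.bracketTrace a' b x := by
  simp only [bracketTrace_eq_trace, ← map_add]
  congr 1
  ext w
  simp [bracketEnd, bracketPlusMinus, evalSection]

theorem bracketTrace_add_right (a b b' : Cₛ^∞⟮𝓘(ℝ, EM); F, E⟯) (x : M) :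
    V.bracketTrace a (b + b') x = V.bracketTrace a b x + V.bracketTrace a b' x := by
  simp only [bracketTrace_eq_trace, ← map_add]
  congr 1
  ext w
  simp [bracketEnd, bracketPlusMinus, bracketMinus, evalSection]

include P in
theorem bracketTrace_smulSection_left {a b : Cₛ^∞⟮𝓘(ℝ, EM); F, E⟯} (ha : ∀ x, a x ∈ V.plus x)
    (hb : ∀ x, b x ∈ V.minus x) (f : C^∞⟮𝓘(ℝ, EM), M; ℝ⟯) (x : M) :
    V.bracketTrace (smulSection f a) b x = f x * V.bracketTrace a b x +
      C.lieDeriv (V.projMinus (C.bracket a b)) f x := by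
  have : Module.Finite ℝ (E x) := P.finite_fibre x
  -- The correction $w\mapsto(\rho([w_+,b]_-)f)\,a$ has rank at most one, so its trace is the
  -- coefficient evaluated at $w=a$.
  have h : V.bracketEnd (smulSection f a) b x = f x • V.bracketEnd a b x +
      (dirDerivForm (C.anchor x ∘ₗ evalSection x ∘ₗ V.bracketMinus b ∘ₗ extendSection x)
        f).smulRight (a x) := by
    ext w
    change V.bracketPlusMinus (smulSection f a) b (extendSection x w) x = _
    rw [V.bracketPlusMinus_smulSection_left ha]
    rfl
  have h2 : V.bracketMinus b (extendSection x (a x)) x = V.bracketMinus b a x := by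
    refine P.apply_eq_of_tensorial (x := x)
      (evalSection x ∘ₗ V.bracketMinus b).toAddMonoidHom (fun f t ↦ ?_)
      (extendSection_apply x (a x))
    change V.bracketMinus b (smulSection f t) x = f x • V.bracketMinus b t x
    rw [V.bracketMinus_smulSection hb, smulSection_apply]
  rw [bracketTrace_eq_trace, h, map_add, map_smul, LinearMap.trace_smulRight,
    ← bracketTrace_eq_trace, smul_eq_mul]
  congr 1
  change dirDeriv (C.anchor x (V.bracketMinus b (extendSection x (a x)) x)) f = _
  rw [h2, bracketMinus_apply, V.projPlus_eq_self ha]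
  rfl

include P in
theorem bracketTrace_smulSection_right {a b : Cₛ^∞⟮𝓘(ℝ, EM); F, E⟯} (ha : ∀ x, a x ∈ V.plus x)
    (hb : ∀ x, b x ∈ V.minus x) (f : C^∞⟮𝓘(ℝ, EM), M; ℝ⟯) (x : M) :
    V.bracketTrace a (smulSection f b) x = f x * V.bracketTrace a b x +
      C.lieDeriv (V.projPlus (C.bracket b a)) f x := by
  have : Module.Finite ℝ (E x) := P.finite_fibre x
  -- Again a correction of rank at most one, $w\mapsto(w_+\cdot f)\,[b,a]_+$, with trace
  -- $[b,a]_+\cdot f$.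
  have h : V.bracketEnd a (smulSection f b) x = f x • V.bracketEnd a b x +
      (dirDerivForm (C.anchor x ∘ₗ V.proj x) f).smulRight
        (V.projPlus (C.bracket b a) x) := by
    ext w
    change V.bracketPlusMinus a (smulSection f b) (extendSection x w) x = _
    rw [V.bracketPlusMinus_smulSection_right ha hb]
    change _ = f x • V.bracketPlusMinus a b (extendSection x w) x +
      dirDeriv (C.anchor x (V.proj x w)) f • V.projPlus (C.bracket b a) x
    conv_rhs => rw [← extendSection_apply (EM := EM) (F := F) x w]
    simp only [extendSection_apply]
    rw [ContMDiffSection.coe_add, Pi.add_apply, smulSection_apply, smulSection_apply,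
      CourantAlgebroid.lieDeriv_apply, projPlus_apply, extendSection_apply]
  rw [bracketTrace_eq_trace, h, map_add, map_smul, LinearMap.trace_smulRight,
    ← bracketTrace_eq_trace, smul_eq_mul]
  congr 1
  change dirDeriv (C.anchor x (V.proj x (V.proj x _))) f = _
  rw [V.proj_eq_self (V.proj_mem x _)]
  rfl

variable (div : Divergence C)

theorem gRic_add_left (a a' b : Cₛ^∞⟮𝓘(ℝ, EM); F, E⟯) (x : M) :
    V.gRic div (a + a') b x = V.gRic div a b x + V.gRic div a' b x := by
  have h := dirDeriv_add (C.anchor x (b x)) ((div.toFun a).mdifferentiableAt_real x)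
    ((div.toFun a').mdifferentiableAt_real x)
  simp only [gRic, bracketTrace_add_left, map_add, ContMDiffMap.coe_add, Pi.add_apply, h]
  ring

theorem gRic_add_right (a b b' : Cₛ^∞⟮𝓘(ℝ, EM); F, E⟯) (x : M) :
    V.gRic div a (b + b') x = V.gRic div a b x + V.gRic div a b' x := by
  simp only [gRic, bracketTrace_add_right, map_add, LinearMap.add_apply, ContMDiffMap.coe_add,
    ContMDiffSection.coe_add, Pi.add_apply, dirDeriv_add_left]
  ring

include P in
-- The terms $(b\cdot f)\,\mathrm{div}\,a$ cancel. What is left is $[b,a]_+\cdot f+a\cdot(b\cdot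
-- f)-b\cdot(a\cdot f)$ from the divergences and $[b,a]_-\cdot f$ from the trace; the sum is zero
-- because the anchor preserves brackets.
theorem gRic_smulSection_left {a b : Cₛ^∞⟮𝓘(ℝ, EM); F, E⟯} (ha : ∀ x, a x ∈ V.plus x)
    (hb : ∀ x, b x ∈ V.minus x) (f : C^∞⟮𝓘(ℝ, EM), M; ℝ⟯) (x : M) :
    V.gRic div (smulSection f a) b x = f x * V.gRic div a b x := by
  have h1 : div.toFun (smulSection f a) = f * div.toFun a + C.lieDeriv a f := by
    ext y
    exact div.leibniz f a y
  have h2 : dirDeriv (C.anchor x (b x)) (div.toFun (smulSection f a)) =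
      f x * dirDeriv (C.anchor x (b x)) (div.toFun a) +
        div.toFun a x * C.lieDeriv b f x + C.lieDeriv b (C.lieDeriv a f) x := by
    rw [h1, ContMDiffMap.coe_add, dirDeriv_add _ ((f * div.toFun a).mdifferentiableAt_real x)
      ((C.lieDeriv a f).mdifferentiableAt_real x), ContMDiffMap.coe_mul,
      dirDeriv_mul _ (f.mdifferentiableAt_real x) ((div.toFun a).mdifferentiableAt_real x)]
    rfl
  have h3 := C.lieDeriv_bracket b a f x
  have h4 : C.bracket a b = -C.bracket b a :=
    C.bracket_swap_of_pairing_eq_zero fun x ↦ V.pairing_eq_zero (ha x) (hb x)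
  have h5 : C.lieDeriv (V.projMinus (C.bracket a b)) f x =
      C.lieDeriv (V.projPlus (C.bracket b a)) f x - C.lieDeriv (C.bracket b a) f x := by
    rw [h4]
    have := dirDeriv_add_left (C.anchor x (V.projMinus (-C.bracket b a) x))
      (C.anchor x (C.bracket b a x)) f
    rw [← map_add] at this
    refine eq_sub_of_add_eq (this.symm.trans ?_)
    rw [CourantAlgebroid.lieDeriv_apply]
    congr 2
    simp
  have h6 := div.leibniz f (V.projPlus (C.bracket b a)) x
  have h7 := div.leibniz (C.lieDeriv b f) a x
  rw [← CourantAlgebroid.lieDeriv_apply] at h6 h7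
  simp only [gRic]
  rw [V.projPlus_bracket_smulSection_right ha, map_add, ContMDiffMap.coe_add, Pi.add_apply, h6, h7,
    h2, V.bracketTrace_smulSection_left P ha hb, h5]
  linear_combination h3

include P in
-- The term $[b,a]_+\cdot f$ from the divergence of $f[b,a]_+$ is cancelled by the one from the
-- trace.
theorem gRic_smulSection_right {a b : Cₛ^∞⟮𝓘(ℝ, EM); F, E⟯} (ha : ∀ x, a x ∈ V.plus x)
    (hb : ∀ x, b x ∈ V.minus x) (f : C^∞⟮𝓘(ℝ, EM), M; ℝ⟯) (x : M) :
    V.gRic div a (smulSection f b) x = f x * V.gRic div a b x := by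
  have h6 := div.leibniz f (V.projPlus (C.bracket b a)) x
  rw [← CourantAlgebroid.lieDeriv_apply] at h6
  simp only [gRic]
  rw [V.projPlus_bracket_smulSection_left ha hb, h6, V.bracketTrace_smulSection_right P ha hb,
    smulSection_apply, map_smul, dirDeriv_smul_left]
  ring

include P in
/-- The generalized Ricci tensor at `x` only depends on the values of its arguments at `x`. -/
theorem gRic_congr {a a' b b' : Cₛ^∞⟮𝓘(ℝ, EM); F, E⟯} (ha : ∀ x, a x ∈ V.plus x)
    (ha' : ∀ x, a' x ∈ V.plus x) (hb : ∀ x, b x ∈ V.minus x) (hb' : ∀ x, b' x ∈ V.minus x)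
    {x : M} (haa' : a x = a' x) (hbb' : b x = b' x) :
    V.gRic div a b x = V.gRic div a' b' x := by
  -- Composing with the projection gives a tensorial map on all sections of `E`, the setting of
  -- `apply_eq_of_tensorial`.
  have h1 : V.gRic div (V.projPlus a) b x = V.gRic div (V.projPlus a') b x :=
    P.apply_eq_of_tensorial (x := x)
      (AddMonoidHom.mk' (fun s ↦ V.gRic div (V.projPlus s) b x) fun s t ↦ by
        rw [map_add, V.gRic_add_left])
      (fun f s ↦ by
        change V.gRic div (V.projPlus (smulSection f s)) b x = _
        rw [V.projPlus_smulSection]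
        exact V.gRic_smulSection_left P div (fun y ↦ V.proj_mem y _) hb f x) haa'
  have h2 : V.gRic div a' (V.projMinus b) x = V.gRic div a' (V.projMinus b') x :=
    P.apply_eq_of_tensorial (x := x)
      (AddMonoidHom.mk' (fun s ↦ V.gRic div a' (V.projMinus s) x) fun s t ↦ by
        rw [map_add, V.gRic_add_right])
      (fun f s ↦ by
        change V.gRic div a' (V.projMinus (smulSection f s)) x = _
        rw [V.projMinus_smulSection]
        exact V.gRic_smulSection_right P div ha' (fun y ↦ V.sub_proj_mem_minus y _) f x) hbb'
  rw [V.projPlus_eq_self ha, V.projPlus_eq_self ha'] at h1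
  rw [V.projMinus_eq_self hb, V.projMinus_eq_self hb'] at h2
  exact h1.trans h2

end LorentzianPseudometric

/-! ### Existence and uniqueness of the pulled-back divergence -/

section Pullback

universe uι

variable {EM : Type*} [NormedAddCommGroup EM] [NormedSpace ℝ EM]
  {M : Type*} [TopologicalSpace M] [ChartedSpace EM M] [IsManifold 𝓘(ℝ, EM) ∞ M]
  {EM' : Type*} [NormedAddCommGroup EM'] [NormedSpace ℝ EM']
  {M' : Type*} [TopologicalSpace M'] [ChartedSpace EM' M'] [IsManifold 𝓘(ℝ, EM') ∞ M']
  {F : Type*} [NormedAddCommGroup F] [NormedSpace ℝ F]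
  {E : M → Type*} [TopologicalSpace (Bundle.TotalSpace F E)] [∀ x, TopologicalSpace (E x)]
  [∀ x, AddCommGroup (E x)] [∀ x, Module ℝ (E x)] [FiberBundle F E] [VectorBundle ℝ F E]
  {𝕜 : Type*} [RCLike 𝕜] {V : Type*} [AddCommGroup V] [Module ℝ V] [FiniteDimensional ℝ V]
  {k n : ℕ} {C : CourantAlgebroid EM F E} {τ : C^∞⟮𝓘(ℝ, EM'), M'; 𝓘(ℝ, EM), M⟯}
  {C' : CourantAlgebroid EM' F ((τ : M' → M) *ᵖ E)} (h : IsCAPullback C τ C')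
  {m : SpinorModel 𝕜 V k} (P : PinStructure.{uι} C m)

theorem pullSection_sub (u v : Cₛ^∞⟮𝓘(ℝ, EM); F, E⟯) :
    pullSection τ (u - v) = pullSection τ u - pullSection τ v :=
  rfl

include h in
-- The vector fields $\rho'(\tau^*u)$ and $\rho(u)$ are $\tau$-related, so this is the chain rule.
theorem IsCAPullback.dirDeriv_comp (u : Cₛ^∞⟮𝓘(ℝ, EM); F, E⟯) {f : M → ℝ} {x : M'}
    (hf : MDifferentiableAt 𝓘(ℝ, EM) 𝓘(ℝ, ℝ) f (τ x)) :
    dirDeriv (C'.anchor x (pullSection τ u x)) (fun y ↦ f (τ y)) =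
      dirDeriv (C.anchor (τ x) (u (τ x))) f := by
  rw [_root_.dirDeriv_comp τ _ hf, h.anchor_eq]

namespace Divergence

variable (div : Divergence C)

theorem toFun_congr [FiniteDimensional ℝ EM] [T2Space M] {x : M}
    {s t : Cₛ^∞⟮𝓘(ℝ, EM); F, E⟯} (hst : ∀ᶠ y in 𝓝 x, s y = t y) :
    div.toFun s x = div.toFun t x := by
  refine eq_of_eventuallyEq_of_leibniz (x := x) (fun s ↦ div.toFun s x) (fun f s hf ↦ ?_) hst
  have hd : dirDeriv (C.anchor x (s x)) f = 0 :=
    (dirDeriv_congr _ hf).trans (dirDeriv_const _ 1)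
  rw [div.leibniz, hd, hf.self_of_nhds, one_mul, add_zero]

variable (C') in
/-- The coefficient of a section of `τ^* E` with respect to the pullback of `basisFrame`. -/
def pullCoeff (i : P.Idx) (s : Cₛ^∞⟮𝓘(ℝ, EM'); F, ((τ : M' → M) *ᵖ E)⟯)
    (α : Fin (Module.finrank ℝ V)) : C^∞⟮𝓘(ℝ, EM'), M'; ℝ⟯ :=
  C'.pairingFun (pullSection τ
    (P.frame i (m.form.dualBasis m.form_nondegenerate (Module.finBasis ℝ V) α))) s

theorem pullCoeff_add (i : P.Idx) (s t : Cₛ^∞⟮𝓘(ℝ, EM'); F, ((τ : M' → M) *ᵖ E)⟯)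
    (α : Fin (Module.finrank ℝ V)) :
    pullCoeff C' P i (s + t) α = pullCoeff C' P i s α + pullCoeff C' P i t α := by
  ext x
  simp [pullCoeff]

theorem pullCoeff_smul (i : P.Idx) (c : ℝ) (s : Cₛ^∞⟮𝓘(ℝ, EM'); F, ((τ : M' → M) *ᵖ E)⟯)
    (α : Fin (Module.finrank ℝ V)) :
    pullCoeff C' P i (c • s) α = c • pullCoeff C' P i s α := by
  ext x
  simp [pullCoeff]

theorem pullCoeff_smulSection (i : P.Idx) (f : C^∞⟮𝓘(ℝ, EM'), M'; ℝ⟯)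
    (s : Cₛ^∞⟮𝓘(ℝ, EM'); F, ((τ : M' → M) *ᵖ E)⟯) (α : Fin (Module.finrank ℝ V)) :
    pullCoeff C' P i (smulSection f s) α = f * pullCoeff C' P i s α := by
  ext x
  simp [pullCoeff]

include h in
theorem sum_pullCoeff {i : P.Idx} {x : M'} (hx : τ x ∈ P.U i)
    (s : Cₛ^∞⟮𝓘(ℝ, EM'); F, ((τ : M' → M) *ᵖ E)⟯) :
    ∑ α, pullCoeff C' P i s α x • pullSection τ (P.basisFrame i α) x = s x :=
  (P.pullback h).sum_coeff (i := i) hx s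

variable (C') in
/-- A local formula for the pullback of a divergence, in the frame of `E` over `U i`. -/
def localPullback (i : P.Idx) :
    Cₛ^∞⟮𝓘(ℝ, EM'); F, ((τ : M' → M) *ᵖ E)⟯ →ₗ[ℝ] C^∞⟮𝓘(ℝ, EM'), M'; ℝ⟯ where
  toFun s := ∑ α, (pullCoeff C' P i s α * (div.toFun (P.basisFrame i α)).comp τ +
    C'.lieDeriv (pullSection τ (P.basisFrame i α)) (pullCoeff C' P i s α))
  map_add' s t := by
    rw [← Finset.sum_add_distrib]
    refine Finset.sum_congr rfl fun α _ ↦ ContMDiffMap.ext fun x ↦ ?_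
    have := dirDeriv_add (C'.anchor x (pullSection τ (P.basisFrame i α) x))
      ((pullCoeff C' P i s α).mdifferentiableAt_real x)
      ((pullCoeff C' P i t α).mdifferentiableAt_real x)
    simp only [pullCoeff_add, ContMDiffMap.coe_add, ContMDiffMap.coe_mul, Pi.add_apply,
      Pi.mul_apply, CourantAlgebroid.lieDeriv_apply, this]
    ring
  map_smul' c s := by
    rw [RingHom.id_apply, Finset.smul_sum]
    refine Finset.sum_congr rfl fun α _ ↦ ContMDiffMap.ext fun x ↦ ?_
    have := dirDeriv_const_smul (C'.anchor x (pullSection τ (P.basisFrame i α) x))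
      ((pullCoeff C' P i s α).mdifferentiableAt_real x) c
    simp only [pullCoeff_smul, ContMDiffMap.coe_add, ContMDiffMap.coe_mul,
      ContMDiffMap.coe_smul, Pi.add_apply, Pi.smul_apply,
      Pi.mul_apply, CourantAlgebroid.lieDeriv_apply, this, smul_eq_mul]
    ring

theorem localPullback_apply (i : P.Idx) (s : Cₛ^∞⟮𝓘(ℝ, EM'); F, ((τ : M' → M) *ᵖ E)⟯) (x : M') :
    div.localPullback C' P i s x =
      ∑ α, (pullCoeff C' P i s α x * div.toFun (P.basisFrame i α) (τ x) +
        dirDeriv (C'.anchor x (pullSection τ (P.basisFrame i α) x))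
          (pullCoeff C' P i s α)) := by
  change ContMDiffMap.coeFnAddMonoidHom _ x = _
  rw [localPullback, LinearMap.coe_mk, AddHom.coe_mk, map_sum, Finset.sum_apply]
  rfl

include h in
-- The product rule for the coefficients of `f s` leaves $\sum_\alpha
-- s^\alpha\,\rho'(\tau^*e_\alpha)f$. This is $\rho'(s)f$ where the coefficients reproduce `s`,
-- hence the condition on `τ x`.
theorem localPullback_smulSection {i : P.Idx} {x : M'} (hx : τ x ∈ P.U i)
    (f : C^∞⟮𝓘(ℝ, EM'), M'; ℝ⟯) (s : Cₛ^∞⟮𝓘(ℝ, EM'); F, ((τ : M' → M) *ᵖ E)⟯) :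
    div.localPullback C' P i (smulSection f s) x =
      f x * div.localPullback C' P i s x + dirDeriv (C'.anchor x (s x)) f := by
  have h1 : dirDeriv (C'.anchor x (s x)) f = ∑ α, pullCoeff C' P i s α x *
      dirDeriv (C'.anchor x (pullSection τ (P.basisFrame i α) x)) f := by
    rw [← sum_pullCoeff h P hx s]
    change dirDerivForm (C'.anchor x) f _ = _
    rw [map_sum]
    simp only [map_smul, smul_eq_mul]
    rfl
  rw [h1, localPullback_apply, localPullback_apply, Finset.mul_sum, ← Finset.sum_add_distrib]
  refine Finset.sum_congr rfl fun α _ ↦ ?_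
  rw [pullCoeff_smulSection, ContMDiffMap.coe_mul, dirDeriv_mul _
    (f.mdifferentiableAt_real x) ((pullCoeff C' P i s α).mdifferentiableAt_real x)]
  simp only [Pi.mul_apply]
  ring

include h in
-- The coefficients of $\tau^*u$ are pullbacks of those of $u$, so the formula becomes, term by
-- term, the Leibniz expansion of $\mathrm{div}\,u$ on $M$.
theorem localPullback_pullSection [FiniteDimensional ℝ EM] [T2Space M] {i : P.Idx} {x : M'}
    (hx : τ x ∈ P.U i) (u : Cₛ^∞⟮𝓘(ℝ, EM); F, E⟯) :
    div.localPullback C' P i (pullSection τ u) x = div.toFun u (τ x) := by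
  have h1 : ∀ᶠ y in 𝓝 (τ x), u y =
      (∑ α, smulSection (P.coeff i u α) (P.basisFrame i α) : Cₛ^∞⟮𝓘(ℝ, EM); F, E⟯) y := by
    filter_upwards [(P.isOpen_U i).mem_nhds hx] with y hy
    rw [ContMDiffSection.sum_apply, ← P.sum_coeff hy u]
    rfl
  have h2 : ∀ α, (pullCoeff C' P i (pullSection τ u) α : M' → ℝ) =
      fun y ↦ P.coeff i u α (τ y) :=
    fun α ↦ funext fun y ↦ h.pairing_eq _ u y
  rw [div.toFun_congr h1, localPullback_apply, map_sum]
  change _ = ContMDiffMap.coeFnAddMonoidHom _ (τ x)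
  rw [map_sum, Finset.sum_apply]
  refine Finset.sum_congr rfl fun α _ ↦ ?_
  rw [h2, h.dirDeriv_comp _ ((P.coeff i u α).mdifferentiableAt_real (τ x))]
  exact (div.leibniz _ _ _).symm

section

variable [FiniteDimensional ℝ EM'] [T2Space M']

include P h in
/-- Two derivations of sections of `τ^* E` over evaluation at `x` with symbol the anchor agree if
they agree on pulled back sections. -/
theorem eq_of_forall_pullSection {x : M'}
    {φ ψ : Cₛ^∞⟮𝓘(ℝ, EM'); F, ((τ : M' → M) *ᵖ E)⟯ →ₗ[ℝ] ℝ}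
    (hφ : ∀ (f : C^∞⟮𝓘(ℝ, EM'), M'; ℝ⟯) s,
      φ (smulSection f s) = f x * φ s + dirDeriv (C'.anchor x (s x)) f)
    (hψ : ∀ (f : C^∞⟮𝓘(ℝ, EM'), M'; ℝ⟯) s,
      ψ (smulSection f s) = f x * ψ s + dirDeriv (C'.anchor x (s x)) f)
    (heq : ∀ u : Cₛ^∞⟮𝓘(ℝ, EM); F, E⟯, φ (pullSection τ u) = ψ (pullSection τ u)) : φ = ψ := by
  obtain ⟨i, hi⟩ := (P.pullback h).cover x
  refine LinearMap.ext fun s ↦ sub_eq_zero.1 ?_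
  -- The symbols cancel, so the difference is tensorial and is determined by its values on the
  -- pulled-back frame.
  have h1 := (P.pullback h).apply_eq_sum_of_tensorial hi (φ - ψ).toAddMonoidHom
    (fun f s ↦ by
      change φ (smulSection f s) - ψ (smulSection f s) = f x • (φ s - ψ s)
      rw [hφ, hψ, smul_eq_mul]
      ring) s
  refine h1.trans (Finset.sum_eq_zero fun α _ ↦ ?_)
  change _ • (φ (pullSection τ _) - ψ (pullSection τ _)) = _
  rw [heq, sub_self, smul_zero]

/-- Evaluation of smooth functions at a point. -/
def _root_.ContMDiffMap.evalLinear (x : M') : C^∞⟮𝓘(ℝ, EM'), M'; ℝ⟯ →ₗ[ℝ] ℝ where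
  toFun f := f x
  map_add' _ _ := rfl
  map_smul' _ _ := rfl

variable [FiniteDimensional ℝ EM] [T2Space M]

include h in
theorem localPullback_eq {i j : P.Idx} {x : M'} (hi : τ x ∈ P.U i) (hj : τ x ∈ P.U j)
    (s : Cₛ^∞⟮𝓘(ℝ, EM'); F, ((τ : M' → M) *ᵖ E)⟯) :
    div.localPullback C' P i s x = div.localPullback C' P j s x :=
  LinearMap.congr_fun (eq_of_forall_pullSection h P
    (φ := ContMDiffMap.evalLinear x ∘ₗ div.localPullback C' P i)
    (ψ := ContMDiffMap.evalLinear x ∘ₗ div.localPullback C' P j)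
    (div.localPullback_smulSection h P hi) (div.localPullback_smulSection h P hj)
    fun u ↦ (div.localPullback_pullSection h P hi u).trans
      (div.localPullback_pullSection h P hj u).symm) s

/-- The value of the pullback of a divergence on a section. -/
def pullbackFun (s : Cₛ^∞⟮𝓘(ℝ, EM'); F, ((τ : M' → M) *ᵖ E)⟯) : C^∞⟮𝓘(ℝ, EM'), M'; ℝ⟯ where
  val x := div.localPullback C' P (P.cover (τ x)).choose s x
  property := by
    intro x
    -- The index chosen at `x` remains admissible nearby, and there the local formulas agree
    -- whatever index is chosen at each point.
    refine ((div.localPullback C' P (P.cover (τ x)).choose s).contMDiff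
      x).congr_of_eventuallyEq ?_
    have hx := ((P.isOpen_U _).preimage τ.contMDiff.continuous).mem_nhds
      (P.cover (τ x)).choose_spec
    filter_upwards [hx] with y hy
    exact div.localPullback_eq h P (P.cover (τ y)).choose_spec hy s

theorem pullbackFun_apply (s : Cₛ^∞⟮𝓘(ℝ, EM'); F, ((τ : M' → M) *ᵖ E)⟯) (x : M') :
    div.pullbackFun h P s x = div.localPullback C' P (P.cover (τ x)).choose s x :=
  rfl

/-- The pullback of a divergence. -/
def pullback : Divergence C' where
  toFun :=
    { toFun := div.pullbackFun h P
      map_add' := fun s t ↦ by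
        ext x
        rw [ContMDiffMap.coe_add, Pi.add_apply]
        simp only [pullbackFun_apply]
        rw [map_add, ContMDiffMap.coe_add, Pi.add_apply]
      map_smul' := fun c s ↦ by
        ext x
        rw [RingHom.id_apply, ContMDiffMap.coe_smul, Pi.smul_apply]
        simp only [pullbackFun_apply]
        rw [map_smul, ContMDiffMap.coe_smul, Pi.smul_apply] }
  leibniz f s x := div.localPullback_smulSection h P (P.cover (τ x)).choose_spec f s

theorem pullback_pullSection (u : Cₛ^∞⟮𝓘(ℝ, EM); F, E⟯) (x : M') :
    (div.pullback h P).toFun (pullSection τ u) x = div.toFun u (τ x) :=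
  div.localPullback_pullSection h P (P.cover (τ x)).choose_spec u

include P h in
/-- A divergence on `τ^* E` is determined by its values on pulled back sections. -/
theorem ext_of_forall_pullSection {d d' : Divergence C'}
    (hd : ∀ (u : Cₛ^∞⟮𝓘(ℝ, EM); F, E⟯) x,
      d.toFun (pullSection τ u) x = d'.toFun (pullSection τ u) x) : d = d' := by
  ext s x
  exact LinearMap.congr_fun (eq_of_forall_pullSection h P
    (φ := ContMDiffMap.evalLinear x ∘ₗ d.toFun) (ψ := ContMDiffMap.evalLinear x ∘ₗ d'.toFun)
    (fun f s ↦ d.leibniz f s x) (fun f s ↦ d'.leibniz f s x) fun u ↦ hd u x) s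

end

end Divergence

end Pullback

/-! ### Pullback of the SUGRA equations -/

section PullbackSolution

universe uι

variable {EM : Type*} [NormedAddCommGroup EM] [NormedSpace ℝ EM] [FiniteDimensional ℝ EM]
  {M : Type*} [TopologicalSpace M] [T2Space M] [ChartedSpace EM M] [IsManifold 𝓘(ℝ, EM) ∞ M]
  {EM' : Type*} [NormedAddCommGroup EM'] [NormedSpace ℝ EM'] [FiniteDimensional ℝ EM']
  {M' : Type*} [TopologicalSpace M'] [T2Space M'] [ChartedSpace EM' M']
  [IsManifold 𝓘(ℝ, EM') ∞ M']
  {F : Type*} [NormedAddCommGroup F] [NormedSpace ℝ F]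
  {E : M → Type*} [TopologicalSpace (Bundle.TotalSpace F E)] [∀ x, TopologicalSpace (E x)]
  [∀ x, AddCommGroup (E x)] [∀ x, Module ℝ (E x)] [FiberBundle F E] [VectorBundle ℝ F E]
  [ContMDiffVectorBundle ∞ F E 𝓘(ℝ, EM)]
  {𝕜 : Type*} [RCLike 𝕜] {V : Type*} [AddCommGroup V] [Module ℝ V] [FiniteDimensional ℝ V]
  {k n : ℕ} {C : CourantAlgebroid EM F E} {τ : C^∞⟮𝓘(ℝ, EM'), M'; 𝓘(ℝ, EM), M⟯}
  {C' : CourantAlgebroid EM' F ((τ : M' → M) *ᵖ E)} (h : IsCAPullback C τ C')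
  {m : SpinorModel 𝕜 V k} (P : PinStructure.{uι} C m) (Vp : LorentzianPseudometric C n)
  (div : Divergence C) (div' : Divergence C')
  (hdiv : ∀ u x, div'.toFun (pullSection τ u) x = div.toFun u (τ x))

include h in
-- Every fibre vector is the value of a section of `E`, so compatibility on pulled-back sections
-- determines the whole form.
theorem IsCAPullback.pairing_fibre (x : M') (v w : E (τ x)) :
    C'.pairing x v w = C.pairing (τ x) v w := by
  obtain ⟨s, rfl⟩ := evalSection_surjective (EM := EM) (F := F) (E := E) (τ x) v
  obtain ⟨t, rfl⟩ := evalSection_surjective (EM := EM) (F := F) (E := E) (τ x) w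
  exact h.pairing_eq s t x

include hdiv h in
theorem dirDeriv_div_pullSection (u v : Cₛ^∞⟮𝓘(ℝ, EM); F, E⟯) (x : M') :
    dirDeriv (C'.anchor x (pullSection τ u x)) (div'.toFun (pullSection τ v)) =
      dirDeriv (C.anchor (τ x) (u (τ x))) (div.toFun v) := by
  rw [← h.dirDeriv_comp u ((div.toFun v).mdifferentiableAt_real (τ x))]
  congr 1
  exact funext (hdiv v)

namespace LorentzianPseudometric

theorem mem_pullback_minus {x : M'} {w : E (τ x)} :
    w ∈ (Vp.pullback h).minus x ↔ w ∈ Vp.minus (τ x) :=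
  forall₂_congr fun v _ ↦ by rw [h.pairing_fibre x v w]

/-- The two sides are defined by independently chosen frames; they agree because orthogonality
characterizes the projection. -/
theorem pullback_proj (x : M') (w : E (τ x)) :
    (Vp.pullback h).proj x w = Vp.proj (τ x) w := by
  refine Vp.proj_unique ((Vp.pullback h).proj_mem x w) fun v hv ↦ ?_
  have h1 := (Vp.pullback h).pairing_proj x w v hv
  rw [h.pairing_fibre x v w] at h1
  exact (h.pairing_fibre x v _).symm.trans h1

theorem projPlus_pullSection (u : Cₛ^∞⟮𝓘(ℝ, EM); F, E⟯) :
    (Vp.pullback h).projPlus (pullSection τ u) = pullSection τ (Vp.projPlus u) := by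
  ext x
  exact Vp.pullback_proj h x (u (τ x))

theorem projMinus_pullSection (u : Cₛ^∞⟮𝓘(ℝ, EM); F, E⟯) :
    (Vp.pullback h).projMinus (pullSection τ u) = pullSection τ (Vp.projMinus u) := by
  simp only [projMinus, LinearMap.sub_apply, LinearMap.id_apply, projPlus_pullSection,
    pullSection_sub]

theorem bracketPlusMinus_pullSection (a b s : Cₛ^∞⟮𝓘(ℝ, EM); F, E⟯) :
    (Vp.pullback h).bracketPlusMinus (pullSection τ a) (pullSection τ b) (pullSection τ s) =
      pullSection τ (Vp.bracketPlusMinus a b s) := by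
  simp only [bracketPlusMinus_apply, bracketMinus_apply, projPlus_pullSection,
    projMinus_pullSection, h.bracket_eq]

include P in
-- The extensions of fibre vectors on $M'$ and on $M$ are unrelated choices. By `bracketEnd_apply`
-- any extension may be used, in particular a section of `E` and its pullback.
theorem bracketTrace_pullSection {a b : Cₛ^∞⟮𝓘(ℝ, EM); F, E⟯} (ha : ∀ x, a x ∈ Vp.plus x)
    (hb : ∀ x, b x ∈ Vp.minus x) (x : M') :
    (Vp.pullback h).bracketTrace (pullSection τ a) (pullSection τ b) x =
      Vp.bracketTrace a b (τ x) := by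
  have key : ∀ w : E (τ x),
      (Vp.pullback h).bracketEnd (pullSection τ a) (pullSection τ b) x w =
        Vp.bracketEnd a b (τ x) w := by
    intro w
    obtain ⟨s, rfl⟩ := evalSection_surjective (EM := EM) (F := F) (E := E) (τ x) w
    have h1 := (Vp.pullback h).bracketEnd_apply (P.pullback h) (a := pullSection τ a)
      (b := pullSection τ b) (fun y ↦ ha (τ y))
      (fun y ↦ (Vp.mem_pullback_minus h).2 (hb (τ y))) (pullSection τ s) x
    rw [Vp.bracketPlusMinus_pullSection] at h1
    exact h1.trans (Vp.bracketEnd_apply P ha hb s (τ x)).symm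
  rw [bracketTrace_eq_trace, bracketTrace_eq_trace]
  exact congrArg (LinearMap.trace ℝ (E (τ x))) (LinearMap.ext key)

include P hdiv in
theorem gRic_pullSection {a b : Cₛ^∞⟮𝓘(ℝ, EM); F, E⟯} (ha : ∀ x, a x ∈ Vp.plus x)
    (hb : ∀ x, b x ∈ Vp.minus x) (x : M') :
    (Vp.pullback h).gRic div' (pullSection τ a) (pullSection τ b) x = Vp.gRic div a b (τ x) := by
  simp only [gRic]
  rw [Vp.bracketTrace_pullSection h P ha hb, dirDeriv_div_pullSection h div div' hdiv,
    h.bracket_eq, projPlus_pullSection, hdiv]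

include hdiv in
theorem frameScalar_pullSection (e : Fin n → Cₛ^∞⟮𝓘(ℝ, EM); F, E⟯) (x : M') :
    (Vp.pullback h).frameScalar div' (fun a ↦ pullSection τ (e a)) x =
      Vp.frameScalar div e (τ x) := by
  simp only [frameScalar]
  simp only [dirDeriv_div_pullSection h div div' hdiv, hdiv, h.bracket_eq, h.pairing_eq,
    projMinus_pullSection]
  rfl

include hdiv in
-- One local frame suffices as a witness, so the frame on $M$ is pulled back.
theorem HasScalarCurvatureAt.pullback {x : M'} {r : ℝ}
    (hr : Vp.HasScalarCurvatureAt div (τ x) r) :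
    (Vp.pullback h).HasScalarCurvatureAt div' x r := by
  obtain ⟨e, he, her⟩ := hr
  refine ⟨fun a ↦ pullSection τ (e a), ?_,
    (Vp.frameScalar_pullSection h div div' hdiv e x).trans her⟩
  filter_upwards [(τ.contMDiff.continuous.tendsto x).eventually he] with y hy
  exact ⟨fun a b ↦ (h.pairing_eq (e a) (e b) y).trans (hy.1 a b), hy.2⟩

end LorentzianPseudometric

variable {P} (A : SpinorField P)

include h in
theorem spinorDeriv_pullback {i : P.Idx} {x : M'} (hx : τ x ∈ P.U i)
    (u : Cₛ^∞⟮𝓘(ℝ, EM); F, E⟯) :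
    spinorDeriv (C'.anchor x (pullSection τ u x)) (fun y ↦ A.rep i (τ y)) =
      spinorDeriv (C.anchor (τ x) (u (τ x))) (A.rep i) := by
  refine Finset.sum_congr rfl fun j _ ↦ ?_
  congr 1
  -- The representative is smooth only on `U i`; openness gives differentiability at `τ x`.
  have hd : MDifferentiableAt 𝓘(ℝ, EM) 𝓘(ℝ, ℝ)
      (fun y ↦ (Module.finBasis ℝ (SpinorSpace 𝕜 k)).repr (A.rep i y) j) (τ x) :=
    ((A.smooth i ((Module.finBasis ℝ (SpinorSpace 𝕜 k)).coord j)).contMDiffAt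
      ((P.isOpen_U i).mem_nhds hx)).mdifferentiableAt (by simp)
  exact h.dirDeriv_comp u hd

include hdiv in
theorem diracOp_pullback {i : P.Idx} {x : M'} (hx : τ x ∈ P.U i) :
    diracOp div' (A.pullback h) i x = diracOp div A i (τ x) := by
  have h1 : ∀ u v w : V, C'.pairing x (C'.bracket ((P.pullback h).frame i u)
      ((P.pullback h).frame i v) x) ((P.pullback h).frame i w x) =
      C.pairing (τ x) (C.bracket (P.frame i u) (P.frame i v) (τ x)) (P.frame i w (τ x)) := by
    intro u v w
    change C'.pairing x (C'.bracket (pullSection τ (P.frame i u))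
      (pullSection τ (P.frame i v)) x) (pullSection τ (P.frame i w) x) = _
    rw [h.bracket_eq, h.pairing_eq]
  have h2 : ∀ v : V, spinorDeriv (C'.anchor x ((P.pullback h).frame i v x))
      ((A.pullback h).rep i) = spinorDeriv (C.anchor (τ x) (P.frame i v (τ x))) (A.rep i) :=
    fun v ↦ spinorDeriv_pullback h A hx (P.frame i v)
  have h3 : ∀ v : V, div'.toFun ((P.pullback h).frame i v) x = div.toFun (P.frame i v) (τ x) :=
    fun v ↦ hdiv _ x
  simp only [diracOp, h1, h2, h3]
  rfl

variable {Vp div A}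

include hdiv in
theorem IsSUGRASolution.pullback {p : ZMod 2} (hsol : IsSUGRASolution Vp div A p) :
    IsSUGRASolution (Vp.pullback h) div' (A.pullback h) p where
  parity i x hx := hsol.parity i (τ x) hx
  self_dual i x hx v hv := by
    -- The fibre, $V_+$ and its orientation are the same at `x` and at `τ x`; only the form has to
    -- be compared.
    refine hsol.self_dual i (τ x) hx v ⟨fun a b ↦ ?_, hv.2⟩
    exact (h.pairing_fibre x _ _).symm.trans (hv.1 a b)
  dirac i x hx := (diracOp_pullback h div div' hdiv A hx).trans (hsol.dirac i (τ x) hx)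
  ricci a b ha hb i x hx v w hv hw := by
    -- The sections `a` and `b` need not be pulled back. They are replaced by pullbacks of global
    -- sections of $V_\pm$ with the same values at `x`; frame sections have these values, and
    -- projecting them keeps them in $V_\pm$ everywhere.
    have ha₀ : ∀ y, Vp.projPlus (P.frame i v) y ∈ Vp.plus y := fun y ↦ Vp.proj_mem y _
    have hb₀ : ∀ y, Vp.projMinus (P.frame i w) y ∈ Vp.minus y := fun y ↦
      Vp.sub_proj_mem_minus y _
    have hv₀ : P.frame i v (τ x) = a x := hv
    have hw₀ : P.frame i w (τ x) = b x := hw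
    have hax : Vp.projPlus (P.frame i v) (τ x) = P.frame i v (τ x) :=
      Vp.proj_eq_self (by rw [hv₀]; exact ha x)
    have hbx : Vp.projMinus (P.frame i w) (τ x) = P.frame i w (τ x) := by
      rw [Vp.projMinus_apply, Vp.proj_eq_zero, sub_zero]
      rw [hw₀]
      exact (Vp.mem_pullback_minus h).1 (hb x)
    have key : (Vp.pullback h).gRic div' a b x =
        Vp.gRic div (Vp.projPlus (P.frame i v)) (Vp.projMinus (P.frame i w)) (τ x) := by
      rw [← Vp.gRic_pullSection h P div div' hdiv ha₀ hb₀]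
      exact (Vp.pullback h).gRic_congr (P.pullback h) div' ha (fun y ↦ ha₀ (τ y)) hb
        (fun y ↦ (Vp.mem_pullback_minus h).2 (hb₀ (τ y)))
        (hv₀.symm.trans hax.symm) (hw₀.symm.trans hbx.symm)
    rw [key]
    exact hsol.ricci _ _ ha₀ hb₀ i (τ x) hx v w hax.symm hbx.symm
  scalar x := (hsol.scalar (τ x)).pullback h Vp div div' hdiv

end PullbackSolution

end

theorem mainTheorem8
    {EM : Type*} [NormedAddCommGroup EM] [NormedSpace ℝ EM] [FiniteDimensional ℝ EM]
    {M : Type*} [TopologicalSpace M] [T2Space M] [SecondCountableTopology M]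
    [ChartedSpace EM M] [IsManifold 𝓘(ℝ, EM) ∞ M]
    {EM' : Type*} [NormedAddCommGroup EM'] [NormedSpace ℝ EM'] [FiniteDimensional ℝ EM']
    {M' : Type*} [TopologicalSpace M'] [T2Space M'] [SecondCountableTopology M']
    [ChartedSpace EM' M'] [IsManifold 𝓘(ℝ, EM') ∞ M']
    {F : Type*} [NormedAddCommGroup F] [NormedSpace ℝ F] [FiniteDimensional ℝ F]
    {E : M → Type*} [TopologicalSpace (Bundle.TotalSpace F E)] [∀ x, TopologicalSpace (E x)]
    [∀ x, AddCommGroup (E x)] [∀ x, Module ℝ (E x)] [FiberBundle F E] [VectorBundle ℝ F E]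
    [ContMDiffVectorBundle ∞ F E 𝓘(ℝ, EM)]
    {𝕜 : Type*} [RCLike 𝕜] {V : Type*} [AddCommGroup V] [Module ℝ V] [FiniteDimensional ℝ V]
    {k n : ℕ} (hn : n % 4 = 2)
    (C : CourantAlgebroid EM F E)
    (τ : C^∞⟮𝓘(ℝ, EM'), M'; 𝓘(ℝ, EM), M⟯)
    (C' : CourantAlgebroid EM' F ((τ : M' → M) *ᵖ E)) (hC' : IsCAPullback C τ C')
    (m : SpinorModel 𝕜 V k) (P : PinStructure C m)
    (Vp : LorentzianPseudometric C n) (div : Divergence C) (A : SpinorField P) (p : ZMod 2)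
    (hsol : IsSUGRASolution Vp div A p) :
    ∃ div' : Divergence C',
      (∀ u x, div'.toFun (pullSection τ u) x = div.toFun u (τ x)) ∧
      (∀ div'' : Divergence C',
        (∀ u x, div''.toFun (pullSection τ u) x = div.toFun u (τ x)) → div'' = div') ∧
      IsSUGRASolution (Vp.pullback hC') div' (A.pullback hC') p := by
  have hdiv := div.pullback_pullSection hC' P
  exact ⟨div.pullback hC' P, hdiv,
    fun _ h ↦ Divergence.ext_of_forall_pullSection hC' P fun u x ↦ (h u x).trans (hdiv u x).symm,
    hsol.pullback hC' _ hdiv⟩
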